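/- A composition algebra is a non-zero real algebra $K$, with identity but not necessarily associative, with a non-degenerate quadratic form $x\mapsto|x|^2$ such that $|xy|^2=|x|^2|y|^2$. Put $\langle x,y\rangle=\tfrac12(|x+y|^2-|x|^2-|y|^2)$, $\operatorname{Re}x=\langle x,1\rangle$, $\overline{x}=2\langle x,1\rangle 1-x$, $K'=\{x:\langle x,1\rangle=0\}$, and write $L_x,R_x$ for left and right multiplication by $x$. Let $\mathfrak{so}(K)$ be the Lie algebra of linear maps of $K$ that are skew for $\langle\cdot,\cdot\rangle$, let $\operatorname{Der}A$ be the derivation algebra of an algebra $A$, let $\overline{A}(x)=\overline{A(\overline{x})}$ for a linear map $A:K\to K$, and let $$\operatorname{Tri}K=\{(A,B,C)\in\mathfrak{so}(K)^3: A(xy)=x(By)+(Cx)y\ \ \forall x,y\in K\}$$ with the componentwise bracket. The map $\theta(A,B,C)=(\overline{B},C,\overline{A})$ is an automorphism of $\operatorname{Tri}K$, and for $x,y\in K$ the triple $$T_{x,y}=(4S_{x,y},\ R_yR_{\overline{x}}-R_xR_{\overline{y}},\ L_yL_{\overline{x}}-L_xL_{\overline{y}}),\qquad S_{x,y}z=\langle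 x,z\rangle y-\langle y,z\rangle x,$$ belongs to $\operatorname{Tri}K$. For $T=(A,B,C)\in\operatorname{Tri}K$ put $T_1=A$, $T_2=\overline{B}$, $T_3=\overline{C}$. Let $H_3(K)$ be the algebra of hermitian $3\times3$ matrices over $K$ with the product $X\cdot Y=XY+YX$, let $H_3'(K)$ be its subspace of traceless matrices, and for $A,B\in H_3(K)$ put $\langle A,B\rangle=\operatorname{Re}\operatorname{tr}(A\cdot B)$ and $A*B=A\cdot B-\tfrac13\operatorname{tr}(A\cdot B)I$; let $L_A$ be the map $X\mapsto A\cdot X$ of $H_3(K)$. For composition algebras $K_1,K_2$ let $$L_3(K_1,K_2)=\operatorname{Der}H_3(K_1)\ \dot{+}\ H_3'(K_1)\otimes K_2'\ \dot{+}\ \operatorname{Der}K_2$$ with the Tits bracket: $\operatorname{Der}H_3(K_1)$ and $\operatorname{Der}K_2$ have their commutator brackets, and for $D\in\operatorname{Der}H_3(K_1)$, $E\in\operatorname{Der}K_2$, $A,B\in H_3'(K_1)$ and $x,y\in K_2'$ $$[D,A\otimes x]=D(A)\otimes x,\quad [E,A\otimes x]=A\otimes E(x),\quad [D,E]=0,$$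 $$[A\otimes x,B\otimes y]=\tfrac16\langle A,B\rangle D_{x,y}+(A*B)\otimes\tfrac12[x,y]-\langle x,y\rangle[L_A,L_B],$$ where $D_{x,y}=[L_x,L_y]+[L_x,R_y]+[R_x,R_y]$. **Theorem.** Let $K_1,K_2$ be any two composition algebras. The Tits bracket is a skew-symmetric bilinear operation on $L_3(K_1,K_2)$, and there is an identification of vector spaces $$L_3(K_1,K_2)=\operatorname{Tri}K_1\oplus\operatorname{Tri}K_2\ \dot{+}\ 3(K_1\otimes K_2)$$ under which the Tits bracket is as follows. Write $F_i(t)$, $i=1,2,3$, for the element of $3(K_1\otimes K_2)=(K_1\otimes K_2)^3$ with $t\in K_1\otimes K_2$ in the $i$-th place and $0$ elsewhere. Then $\operatorname{Tri}K_1\oplus\operatorname{Tri}K_2$ is a Lie subalgebra, the direct sum of the Lie algebras $\operatorname{Tri}K_1$ and $\operatorname{Tri}K_2$ (so that $[\operatorname{Tri}K_1,\operatorname{Tri}K_2]=0$), and for all $T\in\operatorname{Tri}K_1$, $U\in\operatorname{Tri}K_2$, $x_1,y_1\in K_1$, $x_2,y_2\in K_2$ and $i\in\{1,2,3\}$ $$[T,F_i(x_1\otimes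 x_2)]=F_i(T_ix_1\otimes x_2),\qquad [U,F_i(x_1\otimes x_2)]=F_i(x_1\otimes U_ix_2),$$ $$[F_i(x_1\otimes x_2),F_j(y_1\otimes y_2)]=F_k(\overline{y}_1\overline{x}_1\otimes\overline{y}_2\overline{x}_2)\quad\text{if }(i,j,k)\text{ is a cyclic permutation of }(1,2,3),$$ $$[F_i(x_1\otimes x_2),F_i(y_1\otimes y_2)]=\langle x_2,y_2\rangle\,\theta^{1-i}T_{x_1,y_1}+\langle x_1,y_1\rangle\,\theta^{1-i}T_{x_2,y_2}.$$ These formulas are symmetric in $K_1$ and $K_2$; in particular there is a bracket-preserving linear isomorphism $L_3(K_1,K_2)\cong L_3(K_2,K_1)$. -/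

import Mathlib

open scoped TensorProduct

attribute [local instance] LieRing.ofAssociativeRing

noncomputable section

namespace MagicSquare

/-- A (unital, not necessarily associative) real composition algebra: a real algebra with a
non-degenerate multiplicative quadratic form `normSq`, written `|x|²`. The algebra is non-zero, so
that `ℝ` embeds in it as the scalar multiples of the identity. -/
class CompositionAlgebra (K : Type*) [NonAssocRing K] [Module ℝ K] [IsScalarTower ℝ K K]
    [SMulCommClass ℝ K K] extends Nontrivial K where
  normSq : QuadraticForm ℝ K
  nondegenerate : (QuadraticMap.associated (R := ℝ) normSq).Nondegenerate
  normSq_mul : ∀ x y : K, normSq (x * y) = normSq x * normSq y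

section General

variable {V : Type*} [AddCommGroup V] [Module ℝ V]

/-- The Lie algebra of derivations of the algebra with underlying space `V` and product `μ`. -/
def Der (μ : V →ₗ[ℝ] V →ₗ[ℝ] V) : LieSubalgebra ℝ (Module.End ℝ V) where
  carrier := {D | ∀ x y, D (μ x y) = μ (D x) y + μ x (D y)}
  zero_mem' := by simp
  add_mem' := by
    intro D E hD hE x y
    simp only [LinearMap.add_apply, hD x y, hE x y, map_add]
    abel
  smul_mem' := by
    intro c D hD x y
    simp only [LinearMap.smul_apply, hD x y, map_smul, smul_add]
  lie_mem' := by
    intro D E hD hE x y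
    have hD' : ∀ x y, D (μ x y) = μ (D x) y + μ x (D y) := hD
    have hE' : ∀ x y, E (μ x y) = μ (E x) y + μ x (E y) := hE
    simp only [LieRing.of_associative_ring_bracket, LinearMap.sub_apply, Module.End.mul_apply,
      hD', hE', map_add, map_sub]
    abel

/-- For a bilinear product `μ` with left multiplications `L_A = μ A`, the bilinear map
`(A, B) ↦ [L_A, L_B]`. -/
def lieL (μ : V →ₗ[ℝ] V →ₗ[ℝ] V) : V →ₗ[ℝ] V →ₗ[ℝ] Module.End ℝ V :=
  LinearMap.mk₂ ℝ (fun A B => ⁅(μ A : Module.End ℝ V), (μ B : Module.End ℝ V)⁆)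
    (by simp) (by simp) (by simp) (by simp)

end General

section Algebra

variable (K : Type*) [NonAssocRing K] [Module ℝ K] [IsScalarTower ℝ K K] [SMulCommClass ℝ K K]
  [CompositionAlgebra K]

/-- The symmetric bilinear form `⟨x, y⟩ = ½ (|x + y|² - |x|² - |y|²)`. -/
def form : LinearMap.BilinForm ℝ K :=
  QuadraticMap.associated (R := ℝ) (CompositionAlgebra.normSq (K := K))

/-- The conjugation `x ↦ x̄ = 2 ⟨x, 1⟩ 1 - x`: it fixes the multiples of `1` and is `-1` on the
orthogonal complement of `1`. -/
def conj : K →ₗ[ℝ] K :=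
  (2 : ℝ) • ((form K).flip 1).smulRight (1 : K) - LinearMap.id

/-- `K'`, the subspace of `K` orthogonal to `ℝ`. -/
def imK : Submodule ℝ K := LinearMap.ker ((form K).flip 1)

/-- `Ā = conj ∘ A ∘ conj`. -/
def bar : Module.End ℝ K →ₗ[ℝ] Module.End ℝ K where
  toFun A := conj K ∘ₗ A ∘ₗ conj K
  map_add' := by intro A B; ext; simp
  map_smul' := by intro c A; ext; simp

variable {K}

section Basic

local notation "N" => CompositionAlgebra.normSq
local notation "⟪" x ", " y "⟫" => form _ x y

theorem conj_apply (x : K) : conj K x = (2 * ⟪x, 1⟫) • (1 : K) - x := by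
  simp [conj, smul_smul]

theorem bar_apply (A : Module.End ℝ K) (x : K) : bar K A x = conj K (A (conj K x)) := rfl

theorem form_symm (x y : K) : ⟪x, y⟫ = ⟪y, x⟫ :=
  QuadraticMap.associated_isSymm ℝ (N : QuadraticForm ℝ K) x y

theorem form_self (x : K) : ⟪x, x⟫ = N x :=
  QuadraticMap.associated_eq_self_apply ℝ _ x

theorem normSq_add (x y : K) : N (x + y) = N x + N y + 2 * ⟪x, y⟫ := by
  rw [← form_self, ← form_self, ← form_self]
  simp only [map_add, LinearMap.add_apply, form_symm y x]
  ring

theorem form_ext {x y : K} (h : ∀ z, ⟪x, z⟫ = ⟪y, z⟫) : x = y := by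
  have h1 := (CompositionAlgebra.nondegenerate (K := K)).1 (x - y) (fun z => by
    have := h z
    simp only [map_sub, LinearMap.sub_apply]
    simp only [form] at this
    linarith)
  exact sub_eq_zero.mp h1

theorem normSq_one : N (1 : K) = 1 := by
  have h : N (1 : K) * N (1 : K) = N (1 : K) := by
    rw [← CompositionAlgebra.normSq_mul, mul_one]
  have h' : N (1 : K) = 0 ∨ N (1 : K) = 1 := by
    rcases eq_or_ne (N (1 : K)) 0 with h0 | h0
    · exact Or.inl h0
    · exact Or.inr (mul_left_cancel₀ h0 (by rw [h, mul_one]))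
  rcases h' with h0 | h1
  · exfalso
    have hN : ∀ x : K, N x = 0 := fun x => by
      rw [← mul_one x, CompositionAlgebra.normSq_mul, h0, mul_zero]
    have hB : ∀ x y : K, ⟪x, y⟫ = 0 := fun x y => by
      have := normSq_add x y
      rw [hN, hN, hN] at this
      linarith
    exact one_ne_zero (α := K) (form_ext (fun z => by rw [hB, hB]))
  · exact h1

theorem form_one_one : ⟪(1 : K), 1⟫ = 1 := by rw [form_self, normSq_one]

theorem form_mul_left (z x y : K) : ⟪z * x, z * y⟫ = N z * ⟪x, y⟫ := by
  have h := normSq_add (z * x) (z * y)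
  rw [← mul_add] at h
  simp only [CompositionAlgebra.normSq_mul, normSq_add x y] at h
  linarith

theorem form_mul_right (z x y : K) : ⟪x * z, y * z⟫ = ⟪x, y⟫ * N z := by
  have h := normSq_add (x * z) (y * z)
  rw [← add_mul] at h
  simp only [CompositionAlgebra.normSq_mul, normSq_add x y] at h
  linarith

theorem form_mul_mul (z w x y : K) :
    ⟪z * x, w * y⟫ + ⟪w * x, z * y⟫ = 2 * ⟪z, w⟫ * ⟪x, y⟫ := by
  have h := form_mul_left (z + w) x y
  simp only [add_mul, map_add, LinearMap.add_apply, form_mul_left, normSq_add] at h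
  linarith

theorem form_left (a x y : K) : ⟪a * x, y⟫ = ⟪x, conj K a * y⟫ := by
  have h := form_mul_mul a 1 x y
  simp only [one_mul] at h
  rw [conj_apply, sub_mul, smul_mul_assoc, one_mul, map_sub, map_smul, smul_eq_mul]
  linarith

theorem form_right (a x y : K) : ⟪x * a, y⟫ = ⟪x, y * conj K a⟫ := by
  have h := form_mul_mul x y a 1
  simp only [mul_one] at h
  rw [conj_apply, mul_sub, mul_smul_comm, mul_one, map_sub, map_smul, smul_eq_mul,
    form_symm x (y * a)]
  linarith

theorem form_conj_one (x : K) : ⟪conj K x, 1⟫ = ⟪x, 1⟫ := by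
  rw [conj_apply, map_sub, map_smul, LinearMap.sub_apply, LinearMap.smul_apply, form_one_one,
    smul_eq_mul]
  ring

theorem conj_conj (x : K) : conj K (conj K x) = x := by
  rw [conj_apply (conj K x), form_conj_one, conj_apply x]
  abel

theorem conj_one : conj K (1 : K) = 1 := by
  rw [conj_apply, form_one_one, mul_one, two_smul]
  abel

theorem form_conj (x y : K) : ⟪conj K x, y⟫ = ⟪x, conj K y⟫ := by
  simp only [conj_apply, map_sub, map_smul, LinearMap.sub_apply, LinearMap.smul_apply, smul_eq_mul,
    form_symm (1 : K) y]
  ring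

theorem form_conj_conj (x y : K) : ⟪conj K x, conj K y⟫ = ⟪x, y⟫ := by
  rw [form_conj, conj_conj]

theorem conj_mul (x y : K) : conj K (x * y) = conj K y * conj K x := by
  apply form_ext
  intro z
  rw [form_conj, form_left, ← form_right, form_symm, form_left (conj K y), conj_conj]

/-- The trilinear form `⟨x y, z̄⟩` is cyclically symmetric. -/
theorem form_cyclic (x y z : K) : ⟪x * y, conj K z⟫ = ⟪y * z, conj K x⟫ := by
  rw [form_left, ← form_right]

theorem conj_mul_mul (a b c : K) :
    conj K a * (b * c) + conj K b * (a * c) = (2 * ⟪a, b⟫) • c := by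
  apply form_ext
  intro z
  have h := form_mul_mul a b z c
  rw [form_left, form_left] at h
  rw [map_add, LinearMap.add_apply, map_smul, LinearMap.smul_apply, smul_eq_mul,
    form_symm _ z, form_symm _ z, form_symm c z, h]

theorem mul_mul_conj (a b c : K) :
    (c * b) * conj K a + (c * a) * conj K b = (2 * ⟪a, b⟫) • c := by
  apply form_ext
  intro z
  have h := form_mul_mul z c a b
  rw [form_right, form_right] at h
  rw [map_add, LinearMap.add_apply, map_smul, LinearMap.smul_apply, smul_eq_mul,
    form_symm _ z, form_symm (c * a * conj K b) z, form_symm c z]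
  have h2 : ⟪c, z * b * conj K a⟫ = ⟪z, c * a * conj K b⟫ := by
    rw [← form_right, form_symm, form_right]
  rw [h2] at h
  linarith

end Basic

/-! ### Trialities -/

variable (K) in
/-- The triality algebra of `K`: the triples `(A, B, C) = (T 0, T 1, T 2)` in `so(K)³` with
`A (x y) = x (B y) + (C x) y`, with componentwise bracket. -/
def Tri : LieSubalgebra ℝ (Fin 3 → Module.End ℝ K) where
  carrier := {T | (∀ i, T i ∈ skewAdjointLieSubalgebra (form K)) ∧
    ∀ x y, T 0 (x * y) = x * T 1 y + T 2 x * y}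
  zero_mem' := ⟨fun i => (skewAdjointLieSubalgebra (form K)).zero_mem, by simp⟩
  add_mem' := by
    rintro S T ⟨hS, hS'⟩ ⟨hT, hT'⟩
    refine ⟨fun i => (skewAdjointLieSubalgebra (form K)).add_mem (hS i) (hT i), fun x y => ?_⟩
    simp only [Pi.add_apply, LinearMap.add_apply, hS', hT', mul_add, add_mul]
    abel
  smul_mem' := by
    rintro c T ⟨hT, hT'⟩
    refine ⟨fun i => (skewAdjointLieSubalgebra (form K)).smul_mem c (hT i), fun x y => ?_⟩
    simp only [Pi.smul_apply, LinearMap.smul_apply, hT', smul_add, mul_smul_comm, smul_mul_assoc]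
  lie_mem' := by
    rintro S T ⟨hS, hS'⟩ ⟨hT, hT'⟩
    refine ⟨fun i => (skewAdjointLieSubalgebra (form K)).lie_mem (hS i) (hT i), fun x y => ?_⟩
    change S 0 (T 0 (x * y)) - T 0 (S 0 (x * y)) =
      x * (S 1 (T 1 y) - T 1 (S 1 y)) + (S 2 (T 2 x) - T 2 (S 2 x)) * y
    simp only [hS', hT', map_add, mul_sub, sub_mul]
    abel

theorem mem_so_iff (A : Module.End ℝ K) : A ∈ skewAdjointLieSubalgebra (form K) ↔
    ∀ x y, form K (A x) y = - form K x (A y) := by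
  change A ∈ (form K).skewAdjointSubmodule ↔ _
  rw [LinearMap.mem_skewAdjointSubmodule]
  constructor
  · intro h x y
    have := h x y
    simpa using this
  · intro h x y
    simpa using h x y

theorem bar_mem_so {A : Module.End ℝ K} (hA : A ∈ skewAdjointLieSubalgebra (form K)) :
    bar K A ∈ skewAdjointLieSubalgebra (form K) := by
  rw [mem_so_iff] at hA ⊢
  intro x y
  rw [bar_apply, bar_apply, form_conj, hA, form_conj]

theorem bar_bar (A : Module.End ℝ K) : bar K (bar K A) = A := by
  ext x
  simp only [bar_apply, conj_conj]

theorem bar_lie (A B : Module.End ℝ K) : bar K ⁅A, B⁆ = ⁅bar K A, bar K B⁆ := by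
  ext x
  simp only [LieRing.of_associative_ring_bracket, LinearMap.sub_apply, Module.End.mul_apply,
    bar_apply, map_sub, conj_conj]

theorem theta_mem {T : Fin 3 → Module.End ℝ K} (hT : T ∈ Tri K) :
    ![bar K (T 1), T 2, bar K (T 0)] ∈ Tri K := by
  obtain ⟨hs, ht⟩ := hT
  refine ⟨?_, fun x y => ?_⟩
  · intro i
    fin_cases i
    · exact bar_mem_so (hs 1)
    · exact hs 2
    · exact bar_mem_so (hs 0)
  · change bar K (T 1) (x * y) = x * T 2 y + bar K (T 0) x * y
    have h0 := (mem_so_iff _).1 (hs 0)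
    have h1 := (mem_so_iff _).1 (hs 1)
    apply form_ext
    intro w
    obtain ⟨z, rfl⟩ : ∃ z, w = conj K z := ⟨conj K w, (conj_conj w).symm⟩
    have e : form K (T 0 (y * z)) (conj K x) = form K (y * T 1 z) (conj K x)
        + form K (T 2 y * z) (conj K x) := by
      rw [ht, map_add, LinearMap.add_apply]
    have e1 : form K (T 0 (y * z)) (conj K x) = - form K (bar K (T 0) x * y) (conj K z) := by
      rw [h0, form_cyclic (bar K (T 0) x) y z, bar_apply, conj_conj]
    have e2 : form K (y * T 1 z) (conj K x) = - form K (bar K (T 1) (x * y)) (conj K z) := by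
      rw [← form_cyclic, bar_apply, form_conj_conj, ← form_conj, form_symm, h1, form_symm]
    rw [e1, e2, ← form_cyclic x (T 2 y) z] at e
    rw [map_add, LinearMap.add_apply]
    linarith

variable (K) in
/-- The automorphism `θ (A, B, C) = (B̄, C, Ā)` of the triality algebra. -/
def theta : Tri K ≃ₗ⁅ℝ⁆ Tri K where
  toFun T := ⟨![bar K (T.1 1), T.1 2, bar K (T.1 0)], theta_mem T.2⟩
  invFun T := ⟨![bar K (T.1 2), bar K (T.1 0), T.1 1], by
    have h := theta_mem (theta_mem T.2)
    simpa [bar_bar] using h⟩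
  map_add' S T := by
    ext i : 2
    fin_cases i <;> simp
  map_smul' c T := by
    ext i : 2
    fin_cases i <;> simp
  map_lie' := by
    intro S T
    ext i : 2
    fin_cases i
    · exact bar_lie _ _
    · rfl
    · exact bar_lie _ _
  left_inv T := by
    ext i : 2
    fin_cases i <;> simp [bar_bar]
  right_inv T := by
    ext i : 2
    fin_cases i <;> simp [bar_bar]

/-- The maps `T₁ = A`, `T₂ = B̄`, `T₃ = C̄` attached to a triality `T = (A, B, C)` (the index
`i : Fin 3` stands for `i + 1`). -/
def Tri.comp (T : Tri K) : Fin 3 → Module.End ℝ K :=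
  ![T.1 0, bar K (T.1 1), bar K (T.1 2)]

/-- Left multiplication `L_x`. -/
abbrev mulL (x : K) : Module.End ℝ K := LinearMap.mulLeft ℝ x

/-- Right multiplication `R_x`. -/
abbrev mulR (x : K) : Module.End ℝ K := LinearMap.mulRight ℝ x

/-- `S_{x,y} z = ⟨x, z⟩ y - ⟨y, z⟩ x`. -/
def Sxy (x y : K) : Module.End ℝ K :=
  (form K x).smulRight y - (form K y).smulRight x

/-- The triality
`T_{x,y} = (4 S_{x,y}, R_y R_{x̄} - R_x R_{ȳ}, L_y L_{x̄} - L_x L_{ȳ})`. -/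
def Txy (x y : K) : Tri K :=
  ⟨![(4 : ℝ) • Sxy x y, mulR y * mulR (conj K x) - mulR x * mulR (conj K y),
      mulL y * mulL (conj K x) - mulL x * mulL (conj K y)], by
    refine ⟨?_, fun u v => ?_⟩
    · intro i
      fin_cases i
      · refine (mem_so_iff _).2 fun u v => ?_
        simp [Sxy, form_symm u]
        ring
      · refine (mem_so_iff _).2 fun u v => ?_
        simp [form_right, conj_conj]
      · refine (mem_so_iff _).2 fun u v => ?_
        simp [form_left, conj_conj]
    · have h1 := conj_mul_mul (conj K u) (v * conj K x) y
      have h2 := conj_mul_mul (conj K u) (v * conj K y) x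
      have h3 := mul_mul_conj (conj K v) (conj K x * u) y
      have h4 := mul_mul_conj (conj K v) (conj K y * u) x
      have f1 : ∀ x : K, form K (conj K u) (v * conj K x) = form K x (u * v) := by
        intro x
        rw [form_symm, ← form_cyclic u v (conj K x), conj_conj, form_symm]
      have f2 : ∀ x : K, form K (conj K v) (conj K x * u) = form K x (u * v) := by
        intro x
        rw [form_symm, form_cyclic (conj K x) u v, conj_conj, form_symm]
      rw [f1, conj_mul, conj_conj, conj_conj] at h1 h2
      rw [f2, conj_mul, conj_conj, conj_conj] at h3 h4
      simp only [Matrix.cons_val_zero, Matrix.cons_val_one, Matrix.cons_val, Sxy, LinearMap.sub_apply,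
        LinearMap.smul_apply, Module.End.mul_apply, LinearMap.mulLeft_apply,
        LinearMap.mulRight_apply, LinearMap.smulRight_apply, mul_sub, sub_mul]
      rw [← eq_sub_iff_add_eq] at h1 h2 h3 h4
      rw [h1, h2, h3, h4]
      module⟩

/-- The map `D_{x,y} = [L_x, L_y] + [L_x, R_y] + [R_x, R_y]`, bilinear in `x` and `y`. -/
def derK : K →ₗ[ℝ] K →ₗ[ℝ] Module.End ℝ K :=
  LinearMap.mk₂ ℝ (fun x y => ⁅mulL x, mulL y⁆ + ⁅mulL x, mulR y⁆ + ⁅mulR x, mulR y⁆)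
    (by intro x x' y; ext z; simp [LieRing.of_associative_ring_bracket, add_mul, mul_add]; abel)
    (by intro c x y; ext z; simp [LieRing.of_associative_ring_bracket, smul_sub, smul_add,
      smul_mul_assoc, mul_smul_comm])
    (by intro x y y'; ext z; simp [LieRing.of_associative_ring_bracket, add_mul, mul_add]; abel)
    (by intro c x y; ext z; simp [LieRing.of_associative_ring_bracket, smul_sub, smul_add,
      smul_mul_assoc, mul_smul_comm])

/-- The bilinear map `(x, y) ↦ ½ [x, y] = ½ (x y - y x)`. -/
def halfComm : K →ₗ[ℝ] K →ₗ[ℝ] K :=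
  (1 / 2 : ℝ) • (LinearMap.mul ℝ K - (LinearMap.mul ℝ K).flip)

/-! ### Hermitian matrices -/

variable (K) in
/-- The `3 × 3` matrices `X` over `K` with `X† = X`, as a subspace of the space of all matrices. -/
def hermitian : Submodule ℝ (Matrix (Fin 3) (Fin 3) K) where
  carrier := {X | ∀ i j, conj K (X j i) = X i j}
  zero_mem' := by simp
  add_mem' := by
    intro X Y hX hY i j
    rw [Matrix.add_apply, map_add, hX, hY, Matrix.add_apply]
  smul_mem' := by
    intro c X hX i j
    rw [Matrix.smul_apply, map_smul, hX, Matrix.smul_apply]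

variable (K) in
/-- `H₃(K)`: the space of hermitian `3 × 3` matrices over `K`. -/
def H3 : Type _ := hermitian K

instance : AddCommGroup (H3 K) := inferInstanceAs (AddCommGroup (hermitian K))

instance : Module ℝ (H3 K) := inferInstanceAs (Module ℝ (hermitian K))

/-- The inclusion of `H₃(K)` in the space of all matrices. -/
def H3.val : H3 K →ₗ[ℝ] Matrix (Fin 3) (Fin 3) K := (hermitian K).subtype

theorem H3.ext {X Y : H3 K} (h : X.val = Y.val) : X = Y := Subtype.ext h

theorem H3.val_mem (X : H3 K) : X.val ∈ hermitian K := X.2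

/-- A hermitian matrix as an element of `H₃(K)`. -/
def H3.mk (X : Matrix (Fin 3) (Fin 3) K) (hX : X ∈ hermitian K) : H3 K := ⟨X, hX⟩

@[simp]
theorem H3.val_mk (X : Matrix (Fin 3) (Fin 3) K) (hX : X ∈ hermitian K) : (H3.mk X hX).val = X :=
  rfl

theorem jordan_mem {X Y : Matrix (Fin 3) (Fin 3) K} (hX : X ∈ hermitian K)
    (hY : Y ∈ hermitian K) : X * Y + Y * X ∈ hermitian K := by
  have hX' : ∀ i j, conj K (X j i) = X i j := hX
  have hY' : ∀ i j, conj K (Y j i) = Y i j := hY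
  intro i j
  simp only [Matrix.add_apply, Matrix.mul_apply, map_add, map_sum, conj_mul, hX', hY']
  exact add_comm _ _

theorem one_mem_hermitian : (1 : Matrix (Fin 3) (Fin 3) K) ∈ hermitian K := by
  intro i j
  rcases eq_or_ne i j with h | h
  · rw [h, Matrix.one_apply_eq, conj_one]
  · rw [Matrix.one_apply_ne h, Matrix.one_apply_ne h.symm, map_zero]

variable (K) in
/-- The Jordan product `X · Y = X Y + Y X` of `H₃(K)`. -/
def jordan : H3 K →ₗ[ℝ] H3 K →ₗ[ℝ] H3 K :=
  LinearMap.mk₂ ℝ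
    (fun X Y => H3.mk (X.val * Y.val + Y.val * X.val) (jordan_mem X.val_mem Y.val_mem))
    (by intro X X' Y; apply H3.ext; simp [Matrix.add_mul, Matrix.mul_add]; abel)
    (by intro c X Y; apply H3.ext; simp [smul_add])
    (by intro X Y Y'; apply H3.ext; simp [Matrix.add_mul, Matrix.mul_add]; abel)
    (by intro c X Y; apply H3.ext; simp [smul_add])

variable (K) in
/-- The trace `H₃(K) → K`. -/
def tr : H3 K →ₗ[ℝ] K := Matrix.traceLinearMap (Fin 3) ℝ K ∘ₗ H3.val

variable (K) in
/-- `H₃'(K)`: the traceless hermitian matrices. -/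
def H3' : Submodule ℝ (H3 K) := LinearMap.ker (tr K)

variable (K) in
/-- `⟨A, B⟩ = Re (tr (A · B))` on `H₃(K)`, where `Re x = ⟨x, 1⟩`. -/
def formH : H3 K →ₗ[ℝ] H3 K →ₗ[ℝ] ℝ := (jordan K).compr₂ ((form K).flip 1 ∘ₗ tr K)

variable (K) in
/-- `A ∗ B = A · B - ⅓ tr (A · B)`, the traceless part of the Jordan product (the trace of an element
of `H₃(K)` is real, so that `tr (A · B) = ⟨A, B⟩`). -/
def jstar : H3 K →ₗ[ℝ] H3 K →ₗ[ℝ] H3 K :=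
  jordan K -
    (1 / 3 : ℝ) • (formH K).compr₂ (LinearMap.toSpanSingleton ℝ (H3 K) (H3.mk 1 one_mem_hermitian))

end Algebra

/-! ### The magic square algebra -/

section Tits

variable (K₁ : Type*) [NonAssocRing K₁] [Module ℝ K₁] [IsScalarTower ℝ K₁ K₁]
  [SMulCommClass ℝ K₁ K₁] [CompositionAlgebra K₁]
variable (K₂ : Type*) [NonAssocRing K₂] [Module ℝ K₂] [IsScalarTower ℝ K₂ K₂]
  [SMulCommClass ℝ K₂ K₂] [CompositionAlgebra K₂]

/-- The space `End H₃(K₁) ∔ H₃(K₁) ⊗ K₂ ∔ End K₂`, which contains `L₃(K₁, K₂)`. -/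
abbrev Ambient : Type _ :=
  Module.End ℝ (H3 K₁) × (H3 K₁ ⊗[ℝ] K₂) × Module.End ℝ K₂

/-- The vector space `L₃(K₁, K₂) = Der H₃(K₁) ∔ H₃'(K₁) ⊗ K₂' ∔ Der K₂`. The tensor product of the
subspaces `H₃'(K₁)` and `K₂'` is the span of the `A ⊗ x` with `A ∈ H₃'(K₁)` and `x ∈ K₂'`. -/
def L3 : Submodule ℝ (Ambient K₁ K₂) :=
  (Der (jordan K₁)).toSubmodule.prod
    ((Submodule.map₂ (TensorProduct.mk ℝ (H3 K₁) K₂) (H3' K₁) (imK K₂)).prod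
      (Der (LinearMap.mul ℝ K₂)).toSubmodule)

variable {K₁ K₂}

/-- The bracket of Tits, determined by bilinearity and skew-symmetry from
* `[D, D'] = D D' - D' D` and `[E, E'] = E E' - E' E`,
* `[D, A ⊗ x] = D(A) ⊗ x`, `[E, A ⊗ x] = A ⊗ E(x)`, `[D, E] = 0`,
* `[A ⊗ x, B ⊗ y] = ⅙ ⟨A, B⟩ D_{x,y} + (A ∗ B) ⊗ ½ [x, y] - ⟨x, y⟩ [L_A, L_B]`.
The formula makes sense on the whole ambient space. -/
def tits (u v : Ambient K₁ K₂) : Ambient K₁ K₂ :=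
  (⁅u.1, v.1⁆
      - TensorProduct.rid ℝ _ (TensorProduct.map₂ (lieL (jordan K₁)) (form K₂) u.2.1 v.2.1),
    LinearMap.rTensor K₂ u.1 v.2.1 - LinearMap.rTensor K₂ v.1 u.2.1
      + LinearMap.lTensor (H3 K₁) u.2.2 v.2.1 - LinearMap.lTensor (H3 K₁) v.2.2 u.2.1
      + TensorProduct.map₂ (jstar K₁) halfComm u.2.1 v.2.1,
    ⁅u.2.2, v.2.2⁆
      + (1 / 6 : ℝ) • TensorProduct.lid ℝ _ (TensorProduct.map₂ (formH K₁) derK u.2.1 v.2.1))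

/-- The last of the defining formulas of the bracket. -/
theorem tits_tmul (A B : H3 K₁) (x y : K₂) :
    tits ((0, A ⊗ₜ x, 0) : Ambient K₁ K₂) (0, B ⊗ₜ y, 0) =
      (-(form K₂ x y • lieL (jordan K₁) A B), jstar K₁ A B ⊗ₜ halfComm x y,
        ((1 / 6 : ℝ) * formH K₁ A B) • derK x y) := by
  simp [tits, mul_smul]

variable (K₁ K₂)

/-- The vector space `Tri K₁ ∔ Tri K₂ ∔ 3 (K₁ ⊗ K₂)`. -/
abbrev TriModel : Type _ := Tri K₁ × Tri K₂ × (Fin 3 → K₁ ⊗[ℝ] K₂)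

variable {K₁ K₂}

/-- The element `F_i(t)` of `3 (K₁ ⊗ K₂)`: `t` in the `i`-th place. -/
def F (i : Fin 3) (t : K₁ ⊗[ℝ] K₂) : TriModel K₁ K₂ := (0, 0, Pi.single i t)

end Tits

end MagicSquare

end

open MagicSquare

noncomputable section

namespace MagicSquare

/-! Both sides break into the same pieces. Let `e_i` be the diagonal idempotents of H₃(K); a
hermitian matrix is a real diagonal plus three off-diagonal elements `off i x`.

For `K₁`: a triality acts on H₃(K₁) by zero on the diagonal and by `T_i` on `off i`. Skewness
handles the products of `off i` with itself, and the cyclic form of triality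
(`Tri.comp_conj_mul_conj`) handles the products of `off i` with `off (i + 1)`, so this is a
derivation. Conversely, the value of a derivation on the diagonal is matched by three derivations
`dOff i x = [L_e, L_P]` with `e = e_{i+1}` and `P = off i x`; what remains kills the diagonal, hence
preserves each `off i` and is a triality (`exists_derT_add_dOff`). So Der H₃(K₁) = Tri K₁ ∔ 3 K₁.

For `K₂`: a triality is governed by its values at 1. It has a unique form `U_i = D + L_{a_{i+1}} -
R_{a_{i+2}}` with `D` a derivation and `a_i` imaginary of sum zero (`comp_eq`), so `U ↦ ∑ e_i ⊗ a_i
+ D` identifies Tri K₂ with (traceless diagonals) ⊗ K₂' ∔ Der K₂. The remaining off-diagonal part 3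
(K₁ ⊗ K₂') combines with 3 K₁ = 3 (K₁ ⊗ 1) into 3 (K₁ ⊗ K₂).

The brackets are verified for second factors equal to 1 or imaginary. They rest on the values of
`[L_A, L_B]` on H₃(K₁) (`lieL_off_self`, `lieL_off_succ`), on the bracket of two trialities in terms
of `(D, a)` (`triVec_lie_triDer_lie`), and on the pair `(D, a)` of `T_{x,y}` (`triVec_Txy`). The
embedding of `F_i` carries a minus sign because `[dOff i x, dOff (i + 1) y] = -dOff (i + 2) (ȳ x̄)`.
Since the resulting formulas are symmetric in the two algebras, exchanging them gives the last
claim. -/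

theorem fin3_add_one_add_one (i : Fin 3) : i + 1 + 1 = i + 2 := by omega

theorem fin3_add_one_add_two (i : Fin 3) : i + 1 + 2 = i := by omega

theorem fin3_add_two_add_one (i : Fin 3) : i + 2 + 1 = i := by omega

theorem fin3_add_two_add_two (i : Fin 3) : i + 2 + 2 = i + 1 := by omega

theorem fin3_cases (i j : Fin 3) : j = i ∨ j = i + 1 ∨ j = i + 2 := by omega

theorem fin3_sum {M : Type*} [AddCommMonoid M] (i : Fin 3) (f : Fin 3 → M) :
    ∑ j, f j = f i + f (i + 1) + f (i + 2) := by
  rw [Fin.sum_univ_three]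
  fin_cases i
  · rfl
  · exact (add_comm _ _).trans (add_assoc _ _ _).symm |>.trans (by rw [add_right_comm]; simp; abel)
  · simp; abel

theorem fin3_single (i : Fin 3) (c : ℝ) :
    (Pi.single i c : Fin 3 → ℝ) (i + 1) = 0 ∧ (Pi.single i c : Fin 3 → ℝ) (i + 2) = 0 ∧
    (Pi.single (i + 1) c : Fin 3 → ℝ) i = 0 ∧ (Pi.single (i + 1) c : Fin 3 → ℝ) (i + 2) = 0 ∧
    (Pi.single (i + 2) c : Fin 3 → ℝ) i = 0 ∧ (Pi.single (i + 2) c : Fin 3 → ℝ) (i + 1) = 0 := by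
  fin_cases i <;> simp

/-! ### Coordinates on H₃(K) and the Jordan product in them -/

section Coordinates

variable {K : Type*} [NonAssocRing K] [Module ℝ K] [IsScalarTower ℝ K K] [SMulCommClass ℝ K K]
  [CompositionAlgebra K]

theorem diagonal_mem_hermitian (α : Fin 3 → ℝ) :
    Matrix.diagonal (fun i => α i • (1 : K)) ∈ hermitian K := by
  intro i j
  rcases eq_or_ne i j with rfl | h
  · simp [conj_one]
  · simp [h, h.symm]

theorem single_add_single_mem_hermitian (i : Fin 3) (x : K) :
    (Matrix.single (i + 1) (i + 2) x + Matrix.single (i + 2) (i + 1) (conj K x) :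
      Matrix (Fin 3) (Fin 3) K) ∈ hermitian K := by
  intro a b
  simp only [Matrix.add_apply, Matrix.single_apply, map_add, apply_ite (conj K), conj_conj,
    map_zero]
  rw [add_comm]
  simp only [and_comm]

variable (K) in
/-- The diagonal matrix with real entries `α`. -/
def diag : (Fin 3 → ℝ) →ₗ[ℝ] H3 K where
  toFun α := H3.mk _ (diagonal_mem_hermitian α)
  map_add' α β := by
    apply H3.ext
    rw [map_add, H3.val_mk, H3.val_mk, H3.val_mk, Matrix.diagonal_add]
    simp only [Pi.add_apply, add_smul]
  map_smul' c α := by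
    apply H3.ext
    rw [map_smul, H3.val_mk, H3.val_mk, ← Matrix.diagonal_smul]
    congr 1
    ext i
    exact mul_smul c (α i) (1 : K)

/-- The hermitian matrix with `x` in the place `(i + 1, i + 2)`, and otherwise only its conjugate
in the place `(i + 2, i + 1)`. -/
def off (i : Fin 3) : K →ₗ[ℝ] H3 K where
  toFun x := H3.mk _ (single_add_single_mem_hermitian i x)
  map_add' x y := by
    apply H3.ext
    simp only [map_add, H3.val_mk, Matrix.single_add]
    abel
  map_smul' c x := by
    apply H3.ext
    simp only [map_smul, H3.val_mk, RingHom.id_apply, ← Matrix.smul_single, smul_add]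

/-- The real part of the `i`-th diagonal entry. -/
def diagCoord (i : Fin 3) : H3 K →ₗ[ℝ] ℝ :=
  (form K).flip 1 ∘ₗ Matrix.entryLinearMap ℝ K i i ∘ₗ H3.val

/-- The entry in the place `(i + 1, i + 2)`. -/
def offCoord (i : Fin 3) : H3 K →ₗ[ℝ] K :=
  Matrix.entryLinearMap ℝ K (i + 1) (i + 2) ∘ₗ H3.val

theorem diag_val (α : Fin 3 → ℝ) :
    (diag K α).val = Matrix.diagonal fun i => α i • (1 : K) := rfl

theorem off_val (i : Fin 3) (x : K) :
    (off i x).val = Matrix.single (i + 1) (i + 2) x + Matrix.single (i + 2) (i + 1) (conj K x) :=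
  rfl

theorem diagCoord_apply (i : Fin 3) (X : H3 K) : diagCoord i X = form K (X.val i i) 1 := rfl

theorem offCoord_apply (i : Fin 3) (X : H3 K) : offCoord i X = X.val (i + 1) (i + 2) := rfl

@[simp]
theorem diagCoord_diag (i : Fin 3) (α : Fin 3 → ℝ) : diagCoord i (diag K α) = α i := by
  simp [diagCoord_apply, diag_val, form_one_one]

@[simp]
theorem offCoord_diag (i : Fin 3) (α : Fin 3 → ℝ) : offCoord i (diag K α) = 0 := by
  rw [offCoord_apply, diag_val, Matrix.diagonal_apply_ne]
  omega

@[simp]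
theorem diagCoord_off (i j : Fin 3) (x : K) : diagCoord i (off j x) = 0 := by
  have h1 : ¬ (j + 1 = i ∧ j + 2 = i) := by omega
  have h2 : ¬ (j + 2 = i ∧ j + 1 = i) := by omega
  simp [diagCoord_apply, off_val, h1, h2]

@[simp]
theorem offCoord_off_self (i : Fin 3) (x : K) : offCoord i (off i x) = x := by
  simp [offCoord_apply, off_val]

theorem offCoord_off_of_ne {i j : Fin 3} (h : i ≠ j) (x : K) : offCoord i (off j x) = 0 := by
  have h1 : ¬ (j + 1 = i + 1 ∧ j + 2 = i + 2) := by omega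
  have h2 : ¬ (j + 2 = i + 1 ∧ j + 1 = i + 2) := by omega
  rw [offCoord_apply, off_val, Matrix.add_apply, Matrix.single_apply, Matrix.single_apply,
    if_neg h1, if_neg h2, add_zero]

/-- This makes the diagonal entries of a hermitian matrix real, so that `diag` and `off` together
exhaust H₃(K). -/
theorem eq_smul_one_of_conj_eq {x : K} (h : conj K x = x) : x = form K x 1 • (1 : K) := by
  rw [conj_apply, sub_eq_iff_eq_add, ← two_smul ℝ x, mul_smul] at h
  exact (smul_right_injective K (two_ne_zero (α := ℝ)) h).symm

theorem H3.decomp (X : H3 K) :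
    X = diag K (fun i => diagCoord i X) + ∑ i, off i (offCoord i X) := by
  have h := X.val_mem
  have h' : ∀ i j, conj K (X.val j i) = X.val i j := h
  apply H3.ext
  rw [map_add, map_sum]
  ext i j
  rw [Matrix.add_apply, Matrix.sum_apply, diag_val, Fin.sum_univ_three]
  simp only [off_val, Matrix.add_apply, Matrix.single_apply, offCoord_apply, h',
    Matrix.diagonal_apply, diagCoord_apply]
  have e := fun i => eq_smul_one_of_conj_eq (h' i i)
  fin_cases i <;> fin_cases j <;> simp [← e]

theorem H3.ext_coord {X Y : H3 K} (h : ∀ i, diagCoord i X = diagCoord i Y)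
    (h' : ∀ i, offCoord i X = offCoord i Y) : X = Y := by
  rw [X.decomp, Y.decomp]
  simp only [h, h']

theorem H3.induction {p : H3 K → Prop} (hd : ∀ α, p (diag K α)) (ho : ∀ i x, p (off i x))
    (ha : ∀ X Y, p X → p Y → p (X + Y)) (X : H3 K) : p X := by
  rw [X.decomp, Fin.sum_univ_three]
  exact ha _ _ (hd _) (ha _ _ (ha _ _ (ho _ _) (ho _ _)) (ho _ _))

theorem H3.hom_ext {M : Type*} [AddCommGroup M] [Module ℝ M] {f g : H3 K →ₗ[ℝ] M}
    (hd : ∀ α, f (diag K α) = g (diag K α)) (ho : ∀ i x, f (off i x) = g (off i x)) : f = g := by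
  ext X
  exact H3.induction (p := fun X => f X = g X) hd ho
    (fun X Y hX hY => by rw [map_add, map_add, hX, hY]) X

theorem jordan_val (X Y : H3 K) : (jordan K X Y).val = X.val * Y.val + Y.val * X.val := rfl

theorem jordan_comm (X Y : H3 K) : jordan K X Y = jordan K Y X :=
  H3.ext (by rw [jordan_val, jordan_val, add_comm])

theorem mul_conj_add (x y : K) : x * conj K y + y * conj K x = (2 * form K x y) • (1 : K) := by
  have h := mul_mul_conj y x 1
  rwa [one_mul, one_mul, form_symm] at h

theorem conj_mul_add (x y : K) : conj K x * y + conj K y * x = (2 * form K x y) • (1 : K) := by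
  have h := conj_mul_mul x y 1
  rwa [mul_one, mul_one] at h

@[simp]
theorem jordan_diag_diag (α β : Fin 3 → ℝ) :
    jordan K (diag K α) (diag K β) = (2 : ℝ) • diag K (α * β) := by
  apply H3.ext
  rw [jordan_val, map_smul, diag_val, diag_val, diag_val, Matrix.diagonal_mul_diagonal,
    Matrix.diagonal_mul_diagonal]
  ext i j
  rcases eq_or_ne i j with rfl | h
  · simp [smul_smul, mul_comm, mul_two, add_smul]
  · simp [h]

@[simp]
theorem jordan_diag_off (α : Fin 3 → ℝ) (i : Fin 3) (x : K) :
    jordan K (diag K α) (off i x) = (α (i + 1) + α (i + 2)) • off i x := by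
  apply H3.ext
  rw [jordan_val, map_smul, diag_val, off_val]
  ext a b
  fin_cases i <;> fin_cases a <;> fin_cases b <;>
    simp [add_smul] <;> abel

@[simp]
theorem jordan_off_diag (α : Fin 3 → ℝ) (i : Fin 3) (x : K) :
    jordan K (off i x) (diag K α) = (α (i + 1) + α (i + 2)) • off i x := by
  rw [jordan_comm, jordan_diag_off]

theorem jordan_off_self (i : Fin 3) (x y : K) :
    jordan K (off i x) (off i y) =
      (2 * form K x y) • diag K (Pi.single (i + 1) 1 + Pi.single (i + 2) 1) := by
  apply H3.ext
  rw [jordan_val, map_smul, diag_val, off_val, off_val]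
  have e1 := mul_conj_add x y
  have e2 := conj_mul_add x y
  ext a b
  fin_cases i <;> fin_cases a <;> fin_cases b <;>
    simp [Matrix.mul_apply, Matrix.single_apply, e1, e2, Pi.single_apply]

/-- The matrix product has `x y` in the place `(i + 1, i)`, whereas `off (i + 2)` is labelled by its
entry in the transposed place `(i, i + 1)`; hence the conjugate `ȳ x̄`. -/
theorem jordan_off_succ (i : Fin 3) (x y : K) :
    jordan K (off i x) (off (i + 1) y) = off (i + 2) (conj K y * conj K x) := by
  apply H3.ext
  rw [jordan_val, off_val, off_val, off_val]
  ext a b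
  fin_cases i <;> fin_cases a <;> fin_cases b <;>
    simp [Matrix.mul_apply, Matrix.single_apply, conj_mul, conj_conj]

end Coordinates

/-! ### Trialities in cyclic form, and two families of maps of H₃(K) -/

section Derivations

variable {K : Type*} [NonAssocRing K] [Module ℝ K] [IsScalarTower ℝ K K] [SMulCommClass ℝ K K]
  [CompositionAlgebra K]

/-- The bars in `T₁ = A`, `T₂ = B̄`, `T₃ = C̄` are placed so that `θ` becomes a cyclic shift of the
components. -/
theorem comp_theta (T : Tri K) (i : Fin 3) : Tri.comp (theta K T) i = Tri.comp T (i + 1) := by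
  fin_cases i
  · rfl
  · rfl
  · exact bar_bar _

theorem comp_theta_symm (T : Tri K) (i : Fin 3) : Tri.comp ((theta K).symm T) (i + 1) = Tri.comp T i := by
  rw [← comp_theta, LieEquiv.apply_symm_apply]

theorem comp_theta_symm_iterate (T : Tri K) (i j : Fin 3) :
    Tri.comp ((⇑(theta K).symm)^[(i : ℕ)] T) (i + j) = Tri.comp T j := by
  fin_cases i
  · simp
  · simp only [Fin.mk_one, Function.iterate_one, add_comm (1 : Fin 3) j, comp_theta_symm]
  · have h : (⟨2, by omega⟩ : Fin 3) + j = j + 1 + 1 := by fin_cases j <;> rfl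
    rw [h]
    exact (comp_theta_symm ((theta K).symm T) (j + 1)).trans (comp_theta_symm T j)

theorem Tri.comp_skew (T : Tri K) (i : Fin 3) (x y : K) :
    form K (Tri.comp T i x) y = - form K x (Tri.comp T i y) := by
  have h : Tri.comp T i ∈ skewAdjointLieSubalgebra (form K) := by
    obtain ⟨T, hs, ht⟩ := T
    fin_cases i
    · exact hs 0
    · change bar K (T 1) ∈ _
      exact bar_mem_so (hs 1)
    · change bar K (T 2) ∈ _
      exact bar_mem_so (hs 2)
  exact (mem_so_iff _).1 h x y

/-- For `i = 1` this is the defining identity of a triality, and the shift `θ` carries it to the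
other indices. It matches the product `off i x · off (i + 1) y = off (i + 2) (ȳ x̄)`. -/
theorem Tri.comp_conj_mul_conj (T : Tri K) (i : Fin 3) (x y : K) :
    Tri.comp T (i + 2) (conj K y * conj K x) =
      conj K y * conj K (Tri.comp T i x) + conj K (Tri.comp T (i + 1) y) * conj K x := by
  have key : ∀ S : Tri K, Tri.comp S 0 (conj K y * conj K x) =
      conj K y * conj K (Tri.comp S 1 x) + conj K (Tri.comp S 2 y) * conj K x := by
    intro S
    have h := S.2.2 (conj K y) (conj K x)
    simp only [Tri.comp, Matrix.cons_val_zero, Matrix.cons_val_one, Matrix.cons_val, bar_apply,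
      conj_conj]
    exact h
  have h2 := fun S => key (theta K S)
  have h3 := fun S => h2 (theta K S)
  simp only [comp_theta] at h2 h3
  fin_cases i
  · exact h3 T
  · exact key T
  · exact h2 T

theorem Tri.comp_add (S T : Tri K) (i : Fin 3) : Tri.comp (S + T) i = Tri.comp S i + Tri.comp T i := by
  fin_cases i
  · rfl
  · exact map_add (bar K) _ _
  · exact map_add (bar K) _ _

theorem Tri.comp_smul (c : ℝ) (T : Tri K) (i : Fin 3) : Tri.comp (c • T) i = c • Tri.comp T i := by
  fin_cases i
  · rfl
  · exact map_smul (bar K) _ _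
  · exact map_smul (bar K) _ _

theorem Tri.comp_lie (S T : Tri K) (i : Fin 3) : Tri.comp ⁅S, T⁆ i = ⁅Tri.comp S i, Tri.comp T i⁆ := by
  fin_cases i
  · rfl
  · exact bar_lie _ _
  · exact bar_lie _ _

theorem Tri.ext_comp {S T : Tri K} (h : ∀ i, Tri.comp S i = Tri.comp T i) : S = T := by
  apply Subtype.ext
  funext i
  have h1 : bar K (S.1 1) = bar K (T.1 1) := h 1
  have h2 : bar K (S.1 2) = bar K (T.1 2) := h 2
  fin_cases i
  · exact h 0
  · exact (bar_bar _).symm.trans ((congrArg (bar K) h1).trans (bar_bar _))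
  · exact (bar_bar _).symm.trans ((congrArg (bar K) h2).trans (bar_bar _))

/-- The triality with components `T₁, T₂, T₃ = t 0, t 1, t 2`. -/
theorem exists_tri (t : Fin 3 → Module.End ℝ K)
    (hs : ∀ i x y, form K (t i x) y = - form K x (t i y))
    (h : ∀ x y, t 0 (conj K y * conj K x) =
      conj K y * conj K (t 1 x) + conj K (t 2 y) * conj K x) :
    ∃ T : Tri K, ∀ i, Tri.comp T i = t i := by
  refine ⟨⟨![t 0, bar K (t 1), bar K (t 2)], ?_, fun x y => ?_⟩, fun i => ?_⟩
  · have hs' : ∀ i, t i ∈ skewAdjointLieSubalgebra (form K) := fun i => (mem_so_iff _).2 (hs i)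
    intro i
    fin_cases i
    · exact hs' 0
    · exact bar_mem_so (hs' 1)
    · exact bar_mem_so (hs' 2)
  · have := h (conj K y) (conj K x)
    rw [conj_conj, conj_conj] at this
    exact this
  · fin_cases i
    · rfl
    · exact bar_bar _
    · exact bar_bar _

/-- To be a derivation of `H₃(K)` is a condition on diagonal and off-diagonal matrices. -/
theorem mem_der_jordan {D : Module.End ℝ (H3 K)}
    (h1 : ∀ α β, D (jordan K (diag K α) (diag K β)) =
      jordan K (D (diag K α)) (diag K β) + jordan K (diag K α) (D (diag K β)))
    (h2 : ∀ α i x, D (jordan K (diag K α) (off i x)) =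
      jordan K (D (diag K α)) (off i x) + jordan K (diag K α) (D (off i x)))
    (h3 : ∀ i x y, D (jordan K (off i x) (off i y)) =
      jordan K (D (off i x)) (off i y) + jordan K (off i x) (D (off i y)))
    (h4 : ∀ i x y, D (jordan K (off i x) (off (i + 1) y)) =
      jordan K (D (off i x)) (off (i + 1) y) + jordan K (off i x) (D (off (i + 1) y))) :
    D ∈ Der (jordan K) := by
  have symm : ∀ X Y : H3 K, D (jordan K X Y) = jordan K (D X) Y + jordan K X (D Y) →
      D (jordan K Y X) = jordan K (D Y) X + jordan K Y (D X) := by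
    intro X Y h
    rw [jordan_comm Y X, h, jordan_comm (D Y), jordan_comm Y, add_comm]
  have add : ∀ X Y Z : H3 K, D (jordan K X Y) = jordan K (D X) Y + jordan K X (D Y) →
      D (jordan K X Z) = jordan K (D X) Z + jordan K X (D Z) →
      D (jordan K X (Y + Z)) = jordan K (D X) (Y + Z) + jordan K X (D (Y + Z)) := by
    intro X Y Z h h'
    simp only [map_add, h, h']
    abel
  have add' : ∀ X Y Z : H3 K, D (jordan K X Y) = jordan K (D X) Y + jordan K X (D Y) →
      D (jordan K Z Y) = jordan K (D Z) Y + jordan K Z (D Y) →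
      D (jordan K (X + Z) Y) = jordan K (D (X + Z)) Y + jordan K (X + Z) (D Y) := by
    intro X Y Z h h'
    simp only [map_add, LinearMap.add_apply, h, h']
    abel
  intro X Y
  induction X using H3.induction with
  | ha X X' hX hX' => exact add' _ _ _ hX hX'
  | hd α =>
    induction Y using H3.induction with
    | ha Y Y' hY hY' => exact add _ _ _ hY hY'
    | hd β => exact h1 _ _
    | ho i x => exact h2 _ _ _
  | ho i x =>
    induction Y using H3.induction with
    | ha Y Y' hY hY' => exact add _ _ _ hY hY'
    | hd β => exact symm _ _ (h2 _ _ _)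
    | ho j y =>
      rcases fin3_cases i j with rfl | rfl | rfl
      · exact h3 _ _ _
      · exact h4 _ _ _
      · have := h4 (i + 2) y x
        rw [fin3_add_two_add_one] at this
        exact symm _ _ this

theorem lieL_apply {V : Type*} [AddCommGroup V] [Module ℝ V] (μ : V →ₗ[ℝ] V →ₗ[ℝ] V) (A B C : V) :
    lieL μ A B C = μ A (μ B C) - μ B (μ A C) := rfl

/-- A derivation satisfies `[D, L_A] = L_{D A}`. With this, brackets of the `dOff` reduce to the
maps `[L_A, L_B]`. -/
theorem lie_lieL_of_mem_der {V : Type*} [AddCommGroup V] [Module ℝ V] {μ : V →ₗ[ℝ] V →ₗ[ℝ] V}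
    {D : Module.End ℝ V} (hD : D ∈ Der μ) (A B : V) :
    ⁅D, lieL μ A B⁆ = lieL μ (D A) B + lieL μ A (D B) := by
  have hD' : ∀ x y, D (μ x y) = μ (D x) y + μ x (D y) := hD
  ext C
  simp only [LieRing.of_associative_ring_bracket, LinearMap.sub_apply, Module.End.mul_apply,
    LinearMap.add_apply, lieL_apply, hD', map_add, map_sub]
  abel

theorem lieL_swap {V : Type*} [AddCommGroup V] [Module ℝ V] (μ : V →ₗ[ℝ] V →ₗ[ℝ] V) (A B : V) :
    lieL μ A B = - lieL μ B A := by
  ext C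
  simp only [LinearMap.neg_apply, lieL_apply]
  abel

-- All nine products with indices normalised to `i`, `i + 1`, `i + 2`; the simplifier uses each
-- conjunct as a separate rule.
@[simp]
theorem jordan_off_off (i : Fin 3) (x y : K) :
    jordan K (off i x) (off i y) =
        (2 * form K x y) • diag K (Pi.single (i + 1) 1 + Pi.single (i + 2) 1) ∧
    jordan K (off (i + 1) x) (off (i + 1) y) =
        (2 * form K x y) • diag K (Pi.single (i + 2) 1 + Pi.single i 1) ∧
    jordan K (off (i + 2) x) (off (i + 2) y) =
        (2 * form K x y) • diag K (Pi.single i 1 + Pi.single (i + 1) 1) ∧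
    jordan K (off i x) (off (i + 1) y) = off (i + 2) (conj K y * conj K x) ∧
    jordan K (off (i + 1) x) (off (i + 2) y) = off i (conj K y * conj K x) ∧
    jordan K (off (i + 2) x) (off i y) = off (i + 1) (conj K y * conj K x) ∧
    jordan K (off (i + 1) x) (off i y) = off (i + 2) (conj K x * conj K y) ∧
    jordan K (off (i + 2) x) (off (i + 1) y) = off i (conj K x * conj K y) ∧
    jordan K (off i x) (off (i + 2) y) = off (i + 1) (conj K x * conj K y) := by
  have h : ∀ x y : K, jordan K (off (i + 1) x) (off (i + 2) y) = off i (conj K y * conj K x) := by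
    intro x y
    have := jordan_off_succ (i + 1) x y
    rwa [fin3_add_one_add_one, fin3_add_one_add_two] at this
  have h' : ∀ x y : K, jordan K (off (i + 2) x) (off i y) = off (i + 1) (conj K y * conj K x) := by
    intro x y
    have := jordan_off_succ (i + 2) x y
    rwa [fin3_add_two_add_one, fin3_add_two_add_two] at this
  have e1 := jordan_off_self (i + 1) x y
  have e2 := jordan_off_self (i + 2) x y
  rw [fin3_add_one_add_one, fin3_add_one_add_two] at e1
  rw [fin3_add_two_add_one, fin3_add_two_add_two] at e2
  refine ⟨jordan_off_self i x y, e1, e2, jordan_off_succ i x y, h x y, h' x y, ?_, ?_, ?_⟩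
  · rw [jordan_comm, jordan_off_succ]
  · rw [jordan_comm, h]
  · rw [jordan_comm, h']

/-- The map of `H₃(K)` acting by `t i` on the `i`-th off-diagonal entry. -/
def offMap (t : Fin 3 → Module.End ℝ K) : Module.End ℝ (H3 K) :=
  ∑ i, off i ∘ₗ t i ∘ₗ offCoord i

@[simp]
theorem offMap_diag (t : Fin 3 → Module.End ℝ K) (α : Fin 3 → ℝ) : offMap t (diag K α) = 0 := by
  simp [offMap]

@[simp]
theorem offMap_off (t : Fin 3 → Module.End ℝ K) (i : Fin 3) (x : K) :
    offMap t (off i x) = off i (t i x) := by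
  rw [offMap, LinearMap.sum_apply, Finset.sum_eq_single i]
  · simp
  · intro j _ hj
    simp [offCoord_off_of_ne hj]
  · simp

variable (K) in
/-- The derivation of `H₃(K)` attached to a triality. -/
def derT : Tri K →ₗ[ℝ] Module.End ℝ (H3 K) where
  toFun T := offMap (Tri.comp T)
  map_add' S T := H3.hom_ext (by simp) (by simp [Tri.comp_add])
  map_smul' c T := H3.hom_ext (by simp) (by simp [Tri.comp_smul])

@[simp]
theorem derT_diag (T : Tri K) (α : Fin 3 → ℝ) : derT K T (diag K α) = 0 := offMap_diag _ _

@[simp]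
theorem derT_off (T : Tri K) (i : Fin 3) (x : K) : derT K T (off i x) = off i (Tri.comp T i x) :=
  offMap_off _ _ _

theorem derT_mem (T : Tri K) : derT K T ∈ Der (jordan K) := by
  apply mem_der_jordan
  · simp
  · simp
  · intro i x y
    rw [derT_off, derT_off, jordan_off_self, jordan_off_self, jordan_off_self, Tri.comp_skew T,
      map_smul, derT_diag]
    module
  · intro i x y
    rw [derT_off, derT_off, jordan_off_succ, jordan_off_succ, jordan_off_succ,
      derT_off, Tri.comp_conj_mul_conj T, map_add]

theorem derT_lie (S T : Tri K) : derT K ⁅S, T⁆ = ⁅derT K S, derT K T⁆ := by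
  apply H3.hom_ext
  · simp [LieRing.of_associative_ring_bracket]
  · intro i x
    simp [LieRing.of_associative_ring_bracket, Tri.comp_lie]

/-- The derivation `[L_e, L_P]` of `H₃(K)`, with `e` the `(i + 1)`-st diagonal idempotent and
`P = off i x`. -/
def dOff (i : Fin 3) : K →ₗ[ℝ] Module.End ℝ (H3 K) :=
  lieL (jordan K) (diag K (Pi.single (i + 1) 1)) ∘ₗ off i

theorem dOff_def (i : Fin 3) (x : K) :
    dOff i x = lieL (jordan K) (diag K (Pi.single (i + 1) 1)) (off i x) := rfl

@[simp]
theorem dOff_diag (i : Fin 3) (x : K) (β : Fin 3 → ℝ) :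
    dOff i x (diag K β) = -(β (i + 1) - β (i + 2)) • off i x := by
  obtain ⟨h1, h2, h3, h4, h5, h6⟩ := fin3_single i 1
  rw [dOff_def, lieL_apply]
  simp only [jordan_diag_diag, jordan_off_diag, jordan_diag_off, map_smul, Pi.mul_apply,
    Pi.single_eq_same, h4]
  module

theorem dOff_off_self (i : Fin 3) (x y : K) :
    dOff i x (off i y) = (2 * form K x y) • diag K (Pi.single (i + 1) 1 - Pi.single (i + 2) 1) := by
  obtain ⟨h1, h2, h3, h4, h5, h6⟩ := fin3_single i 1
  have e : (Pi.single (i + 1) 1 * (Pi.single (i + 1) 1 + Pi.single (i + 2) 1) : Fin 3 → ℝ) =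
      Pi.single (i + 1) 1 := by
    fin_cases i <;> ext j <;> fin_cases j <;> simp
  rw [dOff_def, lieL_apply]
  simp only [jordan_off_self, jordan_diag_off, map_smul, jordan_diag_diag, Pi.single_eq_same, h4,
    e]
  simp only [map_add, map_sub]
  module

/-- Multiplication by `e_{i+1}` is 1 on `off i` and `off (i + 2)`, whose places involve the index `i
+ 1`, and 0 on `off (i + 1)`. So only one term of the commutator survives, here and on `off (i +
2)`. -/
theorem dOff_off_succ (i : Fin 3) (x y : K) :
    dOff i x (off (i + 1) y) = off (i + 2) (conj K y * conj K x) := by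
  obtain ⟨h1, h2, h3, h4, h5, h6⟩ := fin3_single i 1
  rw [dOff_def, lieL_apply]
  simp only [jordan_off_off, jordan_diag_off, map_smul, fin3_add_one_add_one, fin3_add_one_add_two,
    fin3_add_two_add_one, fin3_add_two_add_two, Pi.single_eq_same, h3, h4]
  module

theorem dOff_off_succ_succ (i : Fin 3) (x y : K) :
    dOff i x (off (i + 2) y) = - off (i + 1) (conj K x * conj K y) := by
  obtain ⟨h1, h2, h3, h4, h5, h6⟩ := fin3_single i 1
  rw [dOff_def, lieL_apply]
  simp only [jordan_off_off, jordan_diag_off, map_smul, fin3_add_one_add_one, fin3_add_one_add_two,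
    fin3_add_two_add_one, fin3_add_two_add_two, Pi.single_eq_same, h3, h4]
  module

end Derivations

/-! ### The inner derivations of H₃(K) and their brackets -/

section DerivationsH3

variable {K : Type*} [NonAssocRing K] [Module ℝ K] [IsScalarTower ℝ K K] [SMulCommClass ℝ K K]
  [CompositionAlgebra K]

/-- Cyclic symmetry of the trilinear form; it compares the diagonal entries produced when three
off-diagonal elements with distinct indices meet. -/
theorem form_conj_mul_conj (x y z : K) :
    form K x (conj K z * conj K y) = form K y (conj K x * conj K z) ∧
    form K (conj K y * conj K x) z = form K y (conj K x * conj K z) := by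
  have h1 := form_cyclic (conj K z) (conj K y) (conj K x)
  have h2 := form_cyclic (conj K y) (conj K x) (conj K z)
  simp only [conj_conj] at h1 h2
  exact ⟨by rw [form_symm, h1, h2, form_symm], by rw [h2, form_symm]⟩

theorem single_mul_eq (α : Fin 3 → ℝ) (i : Fin 3) :
    α * Pi.single i 1 = α i • (Pi.single i 1 : Fin 3 → ℝ) := by
  ext j
  rcases eq_or_ne j i with rfl | h
  · simp
  · simp [h]

theorem diag_mul_add (α : Fin 3 → ℝ) (i j : Fin 3) :
    diag K (α * (Pi.single i 1 + Pi.single j 1)) =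
      α i • diag K (Pi.single i 1) + α j • diag K (Pi.single j 1) := by
  rw [mul_add, map_add, single_mul_eq, single_mul_eq, map_smul, map_smul]

theorem diag_mul_sub (α : Fin 3 → ℝ) (i j : Fin 3) :
    diag K (α * (Pi.single i 1 - Pi.single j 1)) =
      α i • diag K (Pi.single i 1) - α j • diag K (Pi.single j 1) := by
  rw [mul_sub, map_sub, single_mul_eq, single_mul_eq, map_smul, map_smul]

/-- A direct check on the kinds of product in `mem_der_jordan`. Apart from index bookkeeping it
needs only `ā(bc) + b̄(ac) = 2⟨a,b⟩c`, its mirror image, and the cyclic symmetry of the trilinear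
form. -/
theorem dOff_mem (i : Fin 3) (x : K) : dOff i x ∈ Der (jordan K) := by
  obtain ⟨h1, h2, h3, h4, h5, h6⟩ := fin3_single i 1
  apply mem_der_jordan
  · intro α β
    simp only [jordan_diag_diag, dOff_diag, map_smul, LinearMap.smul_apply, jordan_off_diag,
      jordan_diag_off, Pi.mul_apply]
    module
  · intro α j y
    rcases fin3_cases i j with rfl | rfl | rfl
    · simp only [jordan_diag_off, dOff_diag, map_smul, LinearMap.smul_apply, dOff_off_self,
        jordan_diag_diag, diag_mul_sub, jordan_off_self]
      simp only [map_add, map_sub]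
      module
    · simp only [jordan_diag_off, dOff_diag, map_smul, LinearMap.smul_apply, dOff_off_succ,
        jordan_off_off, fin3_add_one_add_one, fin3_add_one_add_two, fin3_add_two_add_one,
        fin3_add_two_add_two]
      module
    · simp only [jordan_diag_off, dOff_diag, map_smul, LinearMap.smul_apply, dOff_off_succ_succ,
        jordan_off_off, fin3_add_one_add_one, fin3_add_one_add_two, fin3_add_two_add_one,
        fin3_add_two_add_two, map_neg]
      module
  · intro j y z
    rcases fin3_cases i j with rfl | rfl | rfl
    · simp only [jordan_off_self, map_smul, dOff_diag, dOff_off_self, jordan_diag_off,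
        jordan_off_diag, LinearMap.smul_apply, Pi.add_apply, Pi.sub_apply, h4, h6,
        Pi.single_eq_same]
      module
    · have e := congrArg (off i) (mul_mul_conj y z x)
      rw [map_add, map_smul] at e
      simp only [jordan_off_off, map_smul, dOff_diag, dOff_off_succ, Pi.add_apply,
        fin3_add_one_add_one, fin3_add_one_add_two, h2, h6, h1, Pi.single_eq_same, conj_mul,
        conj_conj]
      rw [add_comm (off i _), e]
      module
    · have e := congrArg (off i) (conj_mul_mul y z x)
      rw [map_add, map_smul] at e
      simp only [jordan_off_off, map_smul, dOff_diag, dOff_off_succ_succ, Pi.add_apply, map_neg,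
        LinearMap.neg_apply,
        fin3_add_two_add_one, fin3_add_two_add_two, h2, h4, h1, Pi.single_eq_same, conj_mul,
        conj_conj]
      rw [← neg_add, add_comm (off i _), e]
      module
  · intro j y z
    rcases fin3_cases i j with rfl | rfl | rfl
    · have e := congrArg (off (j + 1)) (conj_mul_mul x y z)
      rw [map_add, map_smul] at e
      simp only [jordan_off_off, map_smul, dOff_off_self, dOff_off_succ, dOff_off_succ_succ,
        LinearMap.smul_apply, jordan_diag_off, fin3_add_one_add_one, fin3_add_one_add_two,
        Pi.sub_apply, h3, h4, h5, Pi.single_eq_same, conj_mul, conj_conj]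
      rw [eq_sub_of_add_eq e]
      module
    · obtain ⟨e1, e2⟩ := form_conj_mul_conj x y z
      simp only [fin3_add_one_add_one, fin3_add_one_add_two, fin3_add_two_add_one,
        fin3_add_two_add_two, jordan_off_off, dOff_off_self, dOff_off_succ, dOff_off_succ_succ, map_neg, e1, e2, map_add, map_sub]
      module
    · have e := congrArg (off (i + 2)) (mul_mul_conj x z y)
      rw [map_add, map_smul] at e
      simp only [fin3_add_two_add_one, jordan_off_off, map_smul, dOff_off_self, dOff_off_succ,
        dOff_off_succ_succ, jordan_off_diag, fin3_add_two_add_two, map_neg, LinearMap.neg_apply,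
        Pi.sub_apply, h3, h6, h5, Pi.single_eq_same, conj_mul, conj_conj]
      rw [eq_sub_of_add_eq e]
      module

theorem lieL_diag_diag (α β : Fin 3 → ℝ) : lieL (jordan K) (diag K α) (diag K β) = 0 := by
  apply H3.hom_ext
  · intro γ
    simp only [lieL_apply, jordan_diag_diag, map_smul, LinearMap.zero_apply, mul_left_comm, sub_self]
  · intro i x
    simp only [lieL_apply, jordan_diag_off, map_smul, LinearMap.zero_apply]
    module

theorem lieL_diag_off (α : Fin 3 → ℝ) (i : Fin 3) (x : K) :
    lieL (jordan K) (diag K α) (off i x) = (α (i + 1) - α (i + 2)) • dOff i x := by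
  obtain ⟨h1, h2, h3, h4, h5, h6⟩ := fin3_single i 1
  apply H3.hom_ext
  · intro β
    simp only [lieL_apply, LinearMap.smul_apply, dOff_diag, jordan_off_diag, jordan_diag_diag,
      jordan_diag_off, map_smul, Pi.mul_apply]
    module
  · intro j y
    rw [lieL_apply, LinearMap.smul_apply]
    rcases fin3_cases i j with rfl | rfl | rfl
    · simp only [jordan_off_self, jordan_diag_off, map_smul, jordan_diag_diag, dOff_off_self,
        diag_mul_add]
      simp only [map_add, map_sub]
      module
    · simp only [jordan_off_off, jordan_diag_off, map_smul, dOff_off_succ, fin3_add_one_add_one,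
        fin3_add_one_add_two, fin3_add_two_add_one, fin3_add_two_add_two]
      module
    · simp only [jordan_off_off, jordan_diag_off, map_smul, dOff_off_succ_succ,
        fin3_add_one_add_one, fin3_add_one_add_two, fin3_add_two_add_one, fin3_add_two_add_two]
      module

/-- Both sides are compared on the diagonal and on each `off j`. The same identities as for
`dOff_mem` trade one order of multiplication for the other. -/
theorem lieL_off_succ (i : Fin 3) (x y : K) :
    lieL (jordan K) (off i x) (off (i + 1) y) = - dOff (i + 2) (conj K y * conj K x) := by
  obtain ⟨h1, h2, h3, h4, h5, h6⟩ := fin3_single i 1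
  have d0 := dOff_off_self (i + 2) (conj K y * conj K x)
  have d1 := dOff_off_succ (i + 2) (conj K y * conj K x)
  have d2 := dOff_off_succ_succ (i + 2) (conj K y * conj K x)
  simp only [fin3_add_two_add_one, fin3_add_two_add_two, conj_mul, conj_conj] at d0 d1 d2
  apply H3.hom_ext
  · intro β
    simp only [lieL_apply, LinearMap.neg_apply, dOff_diag, jordan_off_diag, jordan_off_off,
      map_smul, fin3_add_one_add_one, fin3_add_one_add_two, fin3_add_two_add_one,
      fin3_add_two_add_two]
    module
  · intro j z
    rw [lieL_apply, LinearMap.neg_apply]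
    rcases fin3_cases i j with rfl | rfl | rfl
    · have e := congrArg (off (j + 1)) (conj_mul_mul x z y)
      rw [map_add, map_smul] at e
      simp only [jordan_off_off, map_smul, jordan_off_diag, d1, fin3_add_one_add_one,
        fin3_add_one_add_two, Pi.add_apply, h3, h4, h5, Pi.single_eq_same, conj_mul, conj_conj]
      rw [eq_sub_of_add_eq e]
      module
    · have e := congrArg (off i) (mul_mul_conj y z x)
      rw [map_add, map_smul] at e
      simp only [jordan_off_off, map_smul, jordan_off_diag, d2, Pi.add_apply, fin3_add_one_add_one,
        fin3_add_one_add_two, h1, h2, h6,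
        Pi.single_eq_same, conj_mul, conj_conj]
      rw [eq_sub_of_add_eq e]
      module
    · obtain ⟨e1, e2⟩ := form_conj_mul_conj x y z
      simp only [jordan_off_off, d0, e1, e2, fin3_add_one_add_one, fin3_add_one_add_two, map_add,
        map_sub]
      module

theorem comp_Txy_zero (x y z : K) :
    Tri.comp (Txy x y) 0 z = (4 * form K x z) • y - (4 * form K y z) • x := by
  change (4 : ℝ) • (form K x z • y - form K y z • x) = _
  module

theorem comp_Txy_one (x y z : K) :
    Tri.comp (Txy x y) 1 z = conj K y * (x * z) - conj K x * (y * z) := by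
  change conj K ((conj K z * conj K x) * y - (conj K z * conj K y) * x) = _
  simp only [map_sub, conj_mul, conj_conj]

theorem comp_Txy_two (x y z : K) :
    Tri.comp (Txy x y) 2 z = (z * x) * conj K y - (z * y) * conj K x := by
  change conj K (y * (conj K x * conj K z) - x * (conj K y * conj K z)) = _
  simp only [map_sub, conj_mul, conj_conj]

/-- This commutator kills the diagonal, acts on `off i` by `-4 S_{x,y}`, and acts on the other two
places by repeated multiplications. These are the components of `T_{x,y}` up to sign, shifted so
that the first of them falls on the index `i`. -/
theorem lieL_off_self (i : Fin 3) (x y : K) :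
    lieL (jordan K) (off i x) (off i y) =
      - derT K ((⇑(theta K).symm)^[(i : ℕ)] (Txy x y)) := by
  obtain ⟨h1, h2, h3, h4, h5, h6⟩ := fin3_single i 1
  apply H3.hom_ext
  · intro β
    simp only [lieL_apply, LinearMap.neg_apply, derT_diag, jordan_off_diag, jordan_off_self,
      map_smul, form_symm y x]
    module
  · intro j z
    rw [lieL_apply, LinearMap.neg_apply, derT_off]
    rcases fin3_cases i j with rfl | rfl | rfl
    · have e := comp_theta_symm_iterate (Txy x y) j 0
      rw [add_zero] at e
      simp only [e, comp_Txy_zero, jordan_off_self, map_smul, jordan_off_diag, Pi.add_apply,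
        h4, h6, Pi.single_eq_same, map_sub]
      module
    · simp only [comp_theta_symm_iterate, comp_Txy_one, jordan_off_off, map_sub, conj_mul,
        conj_conj]
      module
    · simp only [comp_theta_symm_iterate, comp_Txy_two, jordan_off_off, map_sub, conj_mul,
        conj_conj]
      module

theorem lie_derT_dOff (T : Tri K) (i : Fin 3) (x : K) :
    ⁅derT K T, dOff i x⁆ = dOff i (Tri.comp T i x) := by
  rw [dOff_def, lie_lieL_of_mem_der (derT_mem T), derT_diag, derT_off, dOff_def, map_zero,
    LinearMap.zero_apply, zero_add]

/-- Apply `dOff i x` to the two factors of `[L_e, L_P]`, where `P = off i y`: it sends `e` to `-off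
i x`, and it sends `P` to a diagonal matrix, which contributes nothing because diagonal
multiplications commute. -/
theorem lie_dOff_self (i : Fin 3) (x y : K) :
    ⁅dOff i x, dOff i y⁆ = derT K ((⇑(theta K).symm)^[(i : ℕ)] (Txy x y)) := by
  obtain ⟨h1, h2, h3, h4, h5, h6⟩ := fin3_single i 1
  rw [dOff_def i y, lie_lieL_of_mem_der (dOff_mem i x), dOff_diag, dOff_off_self, map_smul,
    map_smul, LinearMap.smul_apply, lieL_off_self, lieL_diag_diag, Pi.single_eq_same, h4]
  module

theorem lie_dOff_succ (i : Fin 3) (x y : K) :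
    ⁅dOff i x, dOff (i + 1) y⁆ = - dOff (i + 2) (conj K y * conj K x) := by
  obtain ⟨h1, h2, h3, h4, h5, h6⟩ := fin3_single i 1
  rw [dOff_def (i + 1) y, lie_lieL_of_mem_der (dOff_mem i x), dOff_diag, dOff_off_succ,
    lieL_diag_off, map_smul, LinearMap.smul_apply, lieL_off_succ]
  simp only [fin3_add_one_add_one, fin3_add_two_add_one, fin3_add_two_add_two, h6, h5,
    Pi.single_eq_same]
  module

end DerivationsH3

/-! ### Alternativity of K, and trialities as derivations plus multiplications -/

section NonAssoc

variable {R : Type*} [NonAssocRing R]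

theorem add_associator (x y z w : R) :
    associator (x + y) z w = associator x z w + associator y z w := by
  simp only [associator_apply, add_mul]
  abel

theorem associator_add (x y z w : R) :
    associator x (y + z) w = associator x y w + associator x z w := by
  simp only [associator_apply, add_mul, mul_add]
  abel

theorem neg_associator_neg (x y w : R) :
    associator (-x) (-y) w = associator x y w := by
  simp only [associator_apply, neg_mul, mul_neg, neg_neg]

variable [Module ℝ R]

theorem derivation_one {D : Module.End ℝ R} (hD : ∀ x y, D (x * y) = D x * y + x * D y) :
    D 1 = 0 := by
  have h := hD 1 1
  simpa using h

variable [IsScalarTower ℝ R R] [SMulCommClass ℝ R R]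

theorem halfComm_apply (x y : R) : halfComm x y = (1 / 2 : ℝ) • (x * y - y * x) := rfl

end NonAssoc

section AlgebraK

variable {K : Type*} [NonAssocRing K] [Module ℝ K] [IsScalarTower ℝ K K] [SMulCommClass ℝ K K]
  [CompositionAlgebra K]

theorem conj_eq_neg_iff {x : K} : conj K x = -x ↔ form K x 1 = 0 := by
  rw [conj_apply, sub_eq_neg_self, smul_eq_zero, or_iff_left (one_ne_zero (α := K))]
  simp

/-- The polarised form of the quadratic equation `x² = 2⟨x,1⟩x - |x|²1`. -/
theorem mul_add_mul_comm (a b : K) :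
    a * b + b * a = (2 * form K a 1) • b + (2 * form K b 1) • a - (2 * form K a b) • (1 : K) := by
  have h := conj_mul_mul a b 1
  simp only [mul_one, conj_apply, sub_mul, smul_mul_assoc, one_mul] at h
  rw [← h]
  abel

/-- Expand `ā` and `b̄` in `ā(bc) + b̄(ac) = 2⟨a,b⟩c` and subtract the polarised quadratic equation
multiplied by `c`: what is left is the associator relation. -/
theorem associator_self_left (a b c : K) : associator a b c = - associator b a c := by
  have h := conj_mul_mul a b c
  have h' := congrArg (· * c) (mul_add_mul_comm a b)
  simp only [add_mul, sub_mul, smul_mul_assoc, one_mul, conj_apply] at h h'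
  rw [associator_apply, associator_apply, eq_neg_iff_add_eq_zero]
  linear_combination (norm := module) h + h'

theorem associator_self_right (a b c : K) : associator a b c = - associator a c b := by
  have h := mul_mul_conj b c a
  have h' := congrArg (a * ·) (mul_add_mul_comm b c)
  simp only [mul_add, mul_sub, mul_smul_comm, mul_one, conj_apply] at h h'
  rw [associator_apply, associator_apply, eq_neg_iff_add_eq_zero]
  linear_combination (norm := module) - h - h'

theorem associator_cyclic (a b c : K) : associator a b c = associator b c a := by
  rw [associator_self_left, associator_self_right, neg_neg]

theorem mulL_lie (a b z : K) :
    a * (b * z) - b * (a * z) = (a * b - b * a) * z - (2 : ℝ) • associator a b z := by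
  have h1 := associator_self_left a b z
  simp only [associator_apply, sub_mul] at *
  linear_combination (norm := module) h1

theorem mulR_lie (a b z : K) :
    z * b * a - z * a * b = - (z * (a * b - b * a)) - (2 : ℝ) • associator a b z := by
  have h1 := associator_self_right z a b
  have h2 := associator_cyclic z a b
  simp only [associator_apply, mul_sub] at *
  linear_combination (norm := module) h1 - (2 : ℝ) • h2

theorem mulL_mulR_lie (a b z : K) : a * (z * b) - a * z * b = associator a b z := by
  rw [associator_self_right, associator_apply]
  abel

theorem derK_apply (a b z : K) :
    derK a b z = (a * b - b * a) * z - z * (a * b - b * a) - (3 : ℝ) • associator a b z := by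
  change (a * (b * z) - b * (a * z)) + (a * (z * b) - a * z * b) + (z * b * a - z * a * b) = _
  rw [mulL_lie, mulL_mulR_lie, mulR_lie]
  module

/-- Applying `D` to the quadratic equation of `x`, with `D 1 = 0`, gives `⟨Dx,1⟩ x = ⟨x,Dx⟩ 1`. If
`x` is not a scalar both coefficients vanish; polarising `⟨Dx,x⟩ = 0` gives skewness. -/
theorem derivation_skew {D : Module.End ℝ K} (hD : ∀ x y, D (x * y) = D x * y + x * D y)
    (x y : K) : form K (D x) y = - form K x (D y) := by
  have key : ∀ x, form K (D x) x = 0 ∧ form K (D x) 1 = 0 := by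
    intro x
    by_cases hx : ∃ r : ℝ, x = r • 1
    · obtain ⟨r, rfl⟩ := hx
      simp [derivation_one hD]
    have h1 := congrArg D (mul_add_mul_comm x x)
    have h2 := mul_add_mul_comm x (D x)
    simp only [map_add, map_sub, map_smul, hD, derivation_one hD, smul_zero] at h1
    have h3 : form K (D x) 1 • x = form K x (D x) • (1 : K) := by
      linear_combination (norm := module) (1 / 4 : ℝ) • h1 - (1 / 2 : ℝ) • h2
    have h4 : form K (D x) 1 = 0 := by
      by_contra h
      exact hx ⟨(form K (D x) 1)⁻¹ * form K x (D x), by rw [mul_smul, ← h3, inv_smul_smul₀ h]⟩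
    rw [h4, zero_smul, eq_comm, smul_eq_zero, or_iff_left (one_ne_zero (α := K))] at h3
    exact ⟨by rw [form_symm, h3], h4⟩
  have h := (key (x + y)).1
  simp only [map_add, LinearMap.add_apply, (key x).1, (key y).1] at h
  rw [form_symm x]
  linarith

theorem derivation_conj {D : Module.End ℝ K} (hD : ∀ x y, D (x * y) = D x * y + x * D y)
    (x : K) : conj K (D x) = D (conj K x) := by
  have h := derivation_skew hD x 1
  rw [derivation_one hD, map_zero, neg_zero] at h
  rw [conj_eq_neg_iff.2 h, conj_apply, map_sub, map_smul, derivation_one hD, smul_zero, zero_sub]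

theorem exists_tri_of_derivation {D : Module.End ℝ K}
    (hD : ∀ x y, D (x * y) = D x * y + x * D y) : ∃ T : Tri K, ∀ i, Tri.comp T i = D := by
  apply exists_tri (fun _ => D)
  · exact fun _ => derivation_skew hD
  · intro x y
    rw [hD, derivation_conj hD, derivation_conj hD, add_comm]

/-- Imaginary multiplications are skew. Once `a₂ = -a₀ - a₁` is substituted, the two sides of the
triality identity differ by associators that cancel because the associator is alternating. -/
theorem exists_tri_mul {a : Fin 3 → K} (ha : ∀ i, form K (a i) 1 = 0)
    (hs : a 0 + a 1 + a 2 = 0) :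
    ∃ T : Tri K, ∀ i, Tri.comp T i = mulL (a (i + 1)) - mulR (a (i + 2)) := by
  have hc : ∀ i, conj K (a i) = - a i := fun i => conj_eq_neg_iff.2 (ha i)
  apply exists_tri (fun i => mulL (a (i + 1)) - mulR (a (i + 2)))
  · intro i x y
    simp only [LinearMap.sub_apply, LinearMap.mulLeft_apply, LinearMap.mulRight_apply, map_sub]
    rw [form_left, form_right, hc, hc, neg_mul, mul_neg, map_neg, map_neg]
    ring
  · intro x y
    have e0 : a 2 = - a 0 - a 1 := by linear_combination (norm := module) hs
    simp only [LinearMap.sub_apply, LinearMap.mulLeft_apply, LinearMap.mulRight_apply, map_sub,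
      conj_mul, hc, neg_mul, mul_neg]
    change a 1 * _ - _ * a 2 = conj K y * (- (conj K x * a 2) - - (a 0 * conj K x)) +
      (-(conj K y * a 0) - -(a 1 * conj K y)) * conj K x
    rw [e0]
    generalize conj K x = v
    generalize conj K y = u
    have h1 := associator_cyclic u v (a 0)
    have h2 := associator_cyclic v (a 0) u
    have h3 := associator_cyclic (a 1) u v
    have h4 := associator_self_left u (a 0) v
    simp only [associator_apply, mul_sub, sub_mul, mul_neg, neg_mul] at *
    linear_combination (norm := module) h1 + h2 - h3 + h4

/-- The components `aᵢ` of the decomposition `Tᵢ = D + L_{a_{i+1}} - R_{a_{i+2}}` of a triality. -/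
def triVec (i : Fin 3) : Tri K →ₗ[ℝ] K where
  toFun T := (1 / 3 : ℝ) • (Tri.comp T (i + 2) 1 - Tri.comp T (i + 1) 1)
  map_add' S T := by
    simp only [Tri.comp_add, LinearMap.add_apply]
    module
  map_smul' c T := by
    simp only [Tri.comp_smul, LinearMap.smul_apply, RingHom.id_apply]
    module

theorem triVec_apply (T : Tri K) (i : Fin 3) :
    triVec i T = (1 / 3 : ℝ) • (Tri.comp T (i + 2) 1 - Tri.comp T (i + 1) 1) := rfl

variable (K) in
/-- The derivation `D` of the decomposition `Tᵢ = D + L_{a_{i+1}} - R_{a_{i+2}}` of a triality. -/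
def triDer : Tri K →ₗ[ℝ] Module.End ℝ K where
  toFun T := Tri.comp T 0 - mulL (triVec 1 T) + mulR (triVec 2 T)
  map_add' S T := by
    ext z
    simp [Tri.comp_add, add_mul, mul_add]
    abel
  map_smul' c T := by
    ext z
    simp [Tri.comp_smul, smul_add, smul_sub, smul_mul_assoc, mul_smul_comm]

theorem form_comp_one (T : Tri K) (i : Fin 3) : form K (Tri.comp T i 1) 1 = 0 := by
  have h := Tri.comp_skew T i 1 1
  rw [form_symm 1] at h
  linarith

theorem comp_one_add (T : Tri K) (i : Fin 3) :
    Tri.comp T i 1 + Tri.comp T (i + 1) 1 + Tri.comp T (i + 2) 1 = 0 := by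
  have h := Tri.comp_conj_mul_conj T i 1 1
  simp only [conj_one, one_mul, mul_one, conj_eq_neg_iff.2 (form_comp_one T _)] at h
  rw [h]
  abel

theorem form_triVec_one (T : Tri K) (i : Fin 3) : form K (triVec i T) 1 = 0 := by
  simp [triVec_apply, form_comp_one]

theorem triVec_add (T : Tri K) (i : Fin 3) :
    triVec i T + triVec (i + 1) T + triVec (i + 2) T = 0 := by
  simp only [triVec_apply, fin3_add_one_add_one, fin3_add_one_add_two, fin3_add_two_add_one,
    fin3_add_two_add_two]
  module

/-- In `T_i = D + L_{a_{i+1}} - R_{a_{i+2}}` evaluation at 1 must give `a_{i+1} - a_{i+2}`. For a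
sum-zero family this inverts to `3 a_i = T_{i+2} 1 - T_{i+1} 1`, whence the factor `1/3` in
`triVec`. -/
theorem triVec_sub (T : Tri K) (i : Fin 3) :
    triVec (i + 1) T - triVec (i + 2) T = Tri.comp T i 1 := by
  have h := comp_one_add T i
  simp only [triVec_apply, fin3_add_one_add_one, fin3_add_one_add_two, fin3_add_two_add_one,
    fin3_add_two_add_two]
  linear_combination (norm := module) (-1 / 3 : ℝ) • h

/-- A triality all of whose components annihilate `1` consists of three copies of a derivation. -/
theorem derivation_of_comp_one {T : Tri K} (h : ∀ i, Tri.comp T i 1 = 0) :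
    (∀ i, Tri.comp T i = Tri.comp T 0) ∧
      ∀ x y, Tri.comp T 0 (x * y) = Tri.comp T 0 x * y + x * Tri.comp T 0 y := by
  -- Setting one argument of the triality identity to 1 makes each component equal to the next one
  -- conjugated on both sides, in two ways; comparing the two shows that consecutive components
  -- coincide.
  have h1 : ∀ i y, Tri.comp T (i + 2) (conj K y) = conj K (Tri.comp T (i + 1) y) := by
    intro i y
    have := Tri.comp_conj_mul_conj T i 1 y
    simpa [h, conj_one] using this
  have h2 : ∀ i x, Tri.comp T (i + 2) (conj K x) = conj K (Tri.comp T i x) := by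
    intro i x
    have := Tri.comp_conj_mul_conj T i x 1
    simpa [h, conj_one] using this
  have h3 : ∀ i, Tri.comp T (i + 1) = Tri.comp T i := by
    intro i
    ext x
    rw [← conj_conj (Tri.comp T (i + 1) x), ← h1, h2, conj_conj]
  have h4 : ∀ i, Tri.comp T i = Tri.comp T 0 := by
    have e1 := h3 0
    have e2 := h3 1
    intro i
    fin_cases i
    · rfl
    · exact e1
    · exact e2.trans e1
  refine ⟨h4, fun x y => ?_⟩
  have h5 := Tri.comp_conj_mul_conj T 0 (conj K y) (conj K x)
  rw [← h2, ← h1, conj_conj, conj_conj, h4] at h5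
  rw [h5, add_comm]

/-- Subtract from `T` the triality made of the multiplications by the `a_i`. The difference
annihilates 1 in every component, so it is a derivation repeated three times. -/
theorem comp_eq_and_triDer_mem (T : Tri K) :
    (∀ i, Tri.comp T i = triDer K T + mulL (triVec (i + 1) T) - mulR (triVec (i + 2) T)) ∧
      ∀ x y, triDer K T (x * y) = triDer K T x * y + x * triDer K T y := by
  obtain ⟨S, hS⟩ := exists_tri_mul (a := fun i => triVec i T) (form_triVec_one T) (triVec_add T 0)
  have hT : ∀ i, Tri.comp (T - S) i = Tri.comp T i - Tri.comp S i := by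
    intro i
    rw [sub_eq_add_neg, ← neg_one_smul ℝ S, Tri.comp_add, Tri.comp_smul]
    module
  obtain ⟨h1, h2⟩ := derivation_of_comp_one (T := T - S) (by
    intro i
    rw [hT, hS, LinearMap.sub_apply, ← triVec_sub]
    simp)
  have h3 : triDer K T = Tri.comp (T - S) 0 := by
    rw [hT, hS]
    change Tri.comp T 0 - mulL (triVec 1 T) + mulR (triVec 2 T) =
      Tri.comp T 0 - (mulL (triVec 1 T) - mulR (triVec 2 T))
    abel
  refine ⟨fun i => ?_, by rwa [h3]⟩
  rw [h3, ← h1 i, hT, hS]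
  abel

theorem comp_eq (T : Tri K) (i : Fin 3) :
    Tri.comp T i = triDer K T + mulL (triVec (i + 1) T) - mulR (triVec (i + 2) T) :=
  (comp_eq_and_triDer_mem T).1 i

theorem triDer_mul (T : Tri K) (x y : K) :
    triDer K T (x * y) = triDer K T x * y + x * triDer K T y :=
  (comp_eq_and_triDer_mem T).2 x y

theorem triVec_triDer_unique {T : Tri K} {D : Module.End ℝ K} {a : Fin 3 → K}
    (h : ∀ i, Tri.comp T i = D + mulL (a (i + 1)) - mulR (a (i + 2))) (hD : D 1 = 0)
    (hs : ∀ i, a i + a (i + 1) + a (i + 2) = 0) : (∀ i, triVec i T = a i) ∧ triDer K T = D := by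
  have h1 : ∀ i, triVec i T = a i := by
    intro i
    rw [triVec_apply, h, h]
    simp only [fin3_add_one_add_one, fin3_add_one_add_two, fin3_add_two_add_one,
      fin3_add_two_add_two, LinearMap.sub_apply, LinearMap.add_apply, hD,
      LinearMap.mulLeft_apply, LinearMap.mulRight_apply, mul_one, one_mul]
    linear_combination (norm := module) (-1 / 3 : ℝ) • hs i
  refine ⟨h1, ?_⟩
  change Tri.comp T 0 - mulL (triVec 1 T) + mulR (triVec 2 T) = D
  rw [h, h1, h1]
  change D + mulL (a 1) - mulR (a 2) - mulL (a 1) + mulR (a 2) = D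
  abel

/-- The coefficients are those of the Tits bracket on diagonal matrices: `e_i ∗ e_i = 2 e_i - (2/3)
I` accounts for 2 and `2/3`, and `⅙ ⟨e_i, e_i⟩ = 1/3` for the derivation part. By uniqueness of the
decomposition it suffices to compute `[S_i, T_i]`. -/
theorem triVec_lie_triDer_lie (S T : Tri K) :
    (∀ i, triVec i ⁅S, T⁆ = triDer K S (triVec i T) - triDer K T (triVec i S) +
      ((2 : ℝ) • halfComm (triVec i S) (triVec i T) -
        (2 / 3 : ℝ) • ∑ m, halfComm (triVec m S) (triVec m T))) ∧
    triDer K ⁅S, T⁆ = ⁅triDer K S, triDer K T⁆ +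
      (1 / 3 : ℝ) • ∑ m, derK (triVec m S) (triVec m T) := by
  have hS := triVec_add S
  have hT := triVec_add T
  apply triVec_triDer_unique
  · intro i
    rw [Tri.comp_lie, comp_eq S, comp_eq T]
    have hS' := eq_neg_of_add_eq_zero_left ((add_assoc _ _ _).symm.trans (hS i))
    have hT' := eq_neg_of_add_eq_zero_left ((add_assoc _ _ _).symm.trans (hT i))
    have dS := triDer_mul S
    have dT := triDer_mul T
    rw [fin3_sum i, fin3_sum i]
    generalize triDer K S = D at *
    generalize triDer K T = E at *
    generalize triVec (i + 1) S = a1 at *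
    generalize triVec (i + 2) S = a2 at *
    generalize triVec (i + 1) T = b1 at *
    generalize triVec (i + 2) T = b2 at *
    rw [hS', hT']
    ext z
    have e1 := mulL_lie a1 b1 z
    have e2 := mulR_lie a2 b2 z
    have e3 := mulL_mulR_lie a1 b2 z
    have e4 := mulL_mulR_lie b1 a2 z
    have e5 := associator_self_left b1 a2 z
    simp only [LieRing.of_associative_ring_bracket, LinearMap.sub_apply, LinearMap.add_apply,
      Module.End.mul_apply, LinearMap.smul_apply, LinearMap.mulLeft_apply,
      LinearMap.mulRight_apply, dS, dT, derK_apply, halfComm_apply,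
      neg_associator_neg, associator_add, add_associator, mul_add, add_mul, mul_sub, sub_mul,
      smul_mul_assoc, mul_smul_comm, neg_mul, mul_neg] at *
    linear_combination (norm := module) e1 + e2 - e3 + e4 + e5
  · simp [LieRing.of_associative_ring_bracket, derivation_one (triDer_mul S),
      derivation_one (triDer_mul T), derK_apply, associator_apply]
  · intro i
    rw [fin3_sum i]
    have e1 := congrArg (triDer K S) (hT i)
    have e2 := congrArg (triDer K T) (hS i)
    simp only [map_add, map_zero] at e1 e2
    linear_combination (norm := module) e1 - e2

/-- Rewrites the first component `4 S_{x,y}` of `T_{x,y}` as `[[x,y],z] - 2(x,y,z)`, from which its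
derivation part can be read off by comparison with `derK_apply`. -/
theorem four_form_smul_sub {x y : K} (hx : form K x 1 = 0) (hy : form K y 1 = 0) (z : K) :
    (4 * form K x z) • y - (4 * form K y z) • x =
      (x * y - y * x) * z - z * (x * y - y * x) - (2 : ℝ) • associator x y z := by
  have e1 := conj_mul_mul x z y
  have e2 := mul_mul_conj x z y
  have e3 := conj_mul_mul y z x
  have e4 := mul_mul_conj y z x
  have e5 := mulL_mulR_lie x y z
  have e6 := mulL_mulR_lie y x z
  have e7 := associator_self_left x y z
  rw [conj_eq_neg_iff.2 hx, conj_apply z] at e1 e2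
  rw [conj_eq_neg_iff.2 hy, conj_apply z] at e3 e4
  simp only [neg_mul, mul_neg, sub_mul, mul_sub, smul_mul_assoc, mul_smul_comm, one_mul,
    mul_one] at *
  linear_combination (norm := module) e3 + e4 - e1 - e2 - e5 + e6 + e7

theorem triVec_theta_symm_iterate (T : Tri K) (i j : Fin 3) :
    triVec (i + j) ((⇑(theta K).symm)^[(i : ℕ)] T) = triVec j T := by
  simp only [triVec_apply, add_assoc, comp_theta_symm_iterate]

/-- The automorphism `θ` only permutes the `a_i`; the common derivation is unaffected. -/
theorem triDer_theta_symm_iterate (T : Tri K) (i : Fin 3) :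
    triDer K ((⇑(theta K).symm)^[(i : ℕ)] T) = triDer K T := by
  have h := comp_eq ((⇑(theta K).symm)^[(i : ℕ)] T) i
  have h' := comp_theta_symm_iterate T i 0
  rw [triVec_theta_symm_iterate, triVec_theta_symm_iterate] at h
  rw [add_zero, h, comp_eq T 0] at h'
  simpa using h'

/-- The triple `(-4/3, 2/3, 2/3)` is the diagonal of `off 0 u ∗ off 0 v` when `⟨u,v⟩ = 1`, and `2/3`
is also `⅙ ⟨off 0 u, off 0 v⟩`; this makes `[F_i, F_i]` come out as a multiple of `T_{x,y}`. -/
theorem triVec_Txy {x y : K} (hx : form K x 1 = 0) (hy : form K y 1 = 0) :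
    triVec 0 (Txy x y) = (-(4 / 3) : ℝ) • halfComm x y ∧
    triVec 1 (Txy x y) = (2 / 3 : ℝ) • halfComm x y ∧
    triVec 2 (Txy x y) = (2 / 3 : ℝ) • halfComm x y ∧
    triDer K (Txy x y) = (2 / 3 : ℝ) • derK x y := by
  have c0 := comp_Txy_zero x y 1
  have c1 := comp_Txy_one x y 1
  have c2 := comp_Txy_two x y 1
  simp only [conj_eq_neg_iff.2 hx, conj_eq_neg_iff.2 hy, hx, hy, mul_one, one_mul, neg_mul,
    mul_neg] at c0 c1 c2
  have h0 : triVec 0 (Txy x y) = (-(4 / 3) : ℝ) • halfComm x y := by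
    change (1 / 3 : ℝ) • (Tri.comp (Txy x y) 2 1 - Tri.comp (Txy x y) 1 1) = _
    rw [c1, c2, halfComm_apply]
    module
  have h1 : triVec 1 (Txy x y) = (2 / 3 : ℝ) • halfComm x y := by
    change (1 / 3 : ℝ) • (Tri.comp (Txy x y) 0 1 - Tri.comp (Txy x y) 2 1) = _
    rw [c0, c2, halfComm_apply]
    module
  have h2 : triVec 2 (Txy x y) = (2 / 3 : ℝ) • halfComm x y := by
    change (1 / 3 : ℝ) • (Tri.comp (Txy x y) 1 1 - Tri.comp (Txy x y) 0 1) = _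
    rw [c0, c1, halfComm_apply]
    module
  refine ⟨h0, h1, h2, ?_⟩
  ext z
  change Tri.comp (Txy x y) 0 z - triVec 1 (Txy x y) * z + z * triVec 2 (Txy x y) = _
  rw [h1, h2, comp_Txy_zero, four_form_smul_sub hx hy, LinearMap.smul_apply, derK_apply,
    halfComm_apply, smul_mul_assoc, smul_mul_assoc, mul_smul_comm, mul_smul_comm]
  module

theorem triVec_Txy_one {x : K} (hx : form K x 1 = 0) :
    triVec 0 (Txy 1 x) = 0 ∧ triVec 1 (Txy 1 x) = (2 : ℝ) • x ∧
    triVec 2 (Txy 1 x) = -((2 : ℝ) • x) ∧ triDer K (Txy 1 x) = 0 := by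
  have c0 := comp_Txy_zero 1 x 1
  have c1 := comp_Txy_one 1 x 1
  have c2 := comp_Txy_two 1 x 1
  simp only [conj_eq_neg_iff.2 hx, hx, mul_one, one_mul, conj_one, form_one_one] at c0 c1 c2
  have h0 : triVec 0 (Txy 1 x) = 0 := by
    change (1 / 3 : ℝ) • (Tri.comp (Txy 1 x) 2 1 - Tri.comp (Txy 1 x) 1 1) = _
    rw [c1, c2]
    module
  have h1 : triVec 1 (Txy 1 x) = (2 : ℝ) • x := by
    change (1 / 3 : ℝ) • (Tri.comp (Txy 1 x) 0 1 - Tri.comp (Txy 1 x) 2 1) = _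
    rw [c0, c2]
    module
  have h2 : triVec 2 (Txy 1 x) = -((2 : ℝ) • x) := by
    change (1 / 3 : ℝ) • (Tri.comp (Txy 1 x) 1 1 - Tri.comp (Txy 1 x) 0 1) = _
    rw [c0, c1]
    module
  refine ⟨h0, h1, h2, ?_⟩
  ext z
  have e := mul_add_mul_comm x z
  rw [hx] at e
  change Tri.comp (Txy 1 x) 0 z - triVec 1 (Txy 1 x) * z + z * triVec 2 (Txy 1 x) = 0
  rw [h1, h2, comp_Txy_zero, smul_mul_assoc, mul_neg, mul_smul_comm, form_symm 1]
  linear_combination (norm := module) (-2 : ℝ) • e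

end AlgebraK

/-! ### Every derivation of H₃(K) comes from a triality and three elements of K -/

section Classification

variable {K : Type*} [NonAssocRing K] [Module ℝ K] [IsScalarTower ℝ K K] [SMulCommClass ℝ K K]
  [CompositionAlgebra K]

/-- With `offCoord_jordan_diag`, this diagonalises multiplication by a diagonal matrix: the Peirce
decomposition for the `e_i`. -/
theorem diagCoord_jordan_diag (i : Fin 3) (α : Fin 3 → ℝ) (X : H3 K) :
    diagCoord i (jordan K (diag K α) X) = 2 * α i * diagCoord i X := by
  induction X using H3.induction with
  | hd β =>
    simp
    ring
  | ho j x => simp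
  | ha X Y hX hY => rw [map_add, map_add, hX, hY, map_add, mul_add]

theorem offCoord_jordan_diag (i : Fin 3) (α : Fin 3 → ℝ) (X : H3 K) :
    offCoord i (jordan K (diag K α) X) = (α (i + 1) + α (i + 2)) • offCoord i X := by
  induction X using H3.induction with
  | hd β => simp
  | ho j x =>
    rcases eq_or_ne i j with rfl | h
    · simp
    · simp [offCoord_off_of_ne h]
  | ha X Y hX hY => rw [map_add, map_add, hX, hY, map_add, smul_add]

theorem derivation_diag {D : Module.End ℝ (H3 K)} (hD : D ∈ Der (jordan K)) (α : Fin 3 → ℝ) :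
    D (diag K α) = ∑ i, (α (i + 1) - α (i + 2)) •
      off i (offCoord i (D (diag K (Pi.single (i + 1) 1)))) := by
  have hD' : ∀ X Y, D (jordan K X Y) = jordan K (D X) Y + jordan K X (D Y) := hD
  have h : ∀ α β : Fin 3 → ℝ, (2 : ℝ) • D (diag K (α * β)) =
      jordan K (diag K β) (D (diag K α)) + jordan K (diag K α) (D (diag K β)) := by
    intro α β
    rw [← map_smul, ← jordan_diag_diag, hD', jordan_comm (D _)]
  -- In the coordinate `i`, pairing `α` with `e_i` gives the term `2 α_i` times the coordinate of `D
  -- e_i` on both sides; cancelling it leaves no diagonal entry of `D α`.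
  have hd : ∀ α i, diagCoord i (D (diag K α)) = 0 := by
    intro α i
    have := congrArg (diagCoord i) (h α (Pi.single i 1))
    rw [single_mul_eq, map_smul, map_smul, map_add, diagCoord_jordan_diag, diagCoord_jordan_diag,
      map_smul, map_smul, Pi.single_eq_same, smul_eq_mul, smul_eq_mul] at this
    linarith
  have ho : ∀ α i, offCoord i (D (diag K α)) =
      (α (i + 1) - α (i + 2)) • offCoord i (D (diag K (Pi.single (i + 1) 1))) := by
    intro α i
    obtain ⟨h1, h2, h3, h4, h5, h6⟩ := fin3_single i 1
    have := congrArg (offCoord i) (h α (Pi.single (i + 1) 1))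
    rw [single_mul_eq, map_smul, map_smul, map_add, offCoord_jordan_diag, offCoord_jordan_diag,
      map_smul, map_smul, Pi.single_eq_same, h4] at this
    linear_combination (norm := module) -this
  rw [H3.decomp (D (diag K α))]
  have e : (fun i => diagCoord i (D (diag K α))) = 0 := funext (hd α)
  rw [e, map_zero, zero_add]
  exact Finset.sum_congr rfl fun i _ => by rw [ho, map_smul]

/-- A derivation killing the diagonal commutes with multiplication by diagonal matrices, so it
preserves each Peirce space `off i`. The maps it induces there are skew by the products of `off i`
with itself, and satisfy the triality identity by the product of `off 1` and `off 2`. -/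
theorem exists_derT_of_diag {D : Module.End ℝ (H3 K)} (hD : D ∈ Der (jordan K))
    (h0 : ∀ α, D (diag K α) = 0) : ∃ T : Tri K, D = derT K T := by
  have hD' : ∀ X Y, D (jordan K X Y) = jordan K (D X) Y + jordan K X (D Y) := hD
  have h1 : ∀ i x, D (off i x) = off i (offCoord i (D (off i x))) := by
    intro i x
    obtain ⟨h1, h2, h3, h4, h5, h6⟩ := fin3_single i 1
    have h : ∀ α : Fin 3 → ℝ, (α (i + 1) + α (i + 2)) • D (off i x) =
        jordan K (diag K α) (D (off i x)) := by
      intro α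
      rw [← map_smul, ← jordan_diag_off, hD', h0, map_zero, LinearMap.zero_apply, zero_add]
    -- `D (off i x)` is killed by `e_i` and fixed by `e_{i+1}`; together these eigenvalues single
    -- out `off i`.
    have e := h (Pi.single i 1)
    have f := h (Pi.single (i + 1) 1)
    rw [h1, h2, add_zero, zero_smul] at e
    rw [h4, Pi.single_eq_same, add_zero, one_smul] at f
    have ed := fun j => congrArg (diagCoord j) e
    have eo := fun j => congrArg (offCoord j) e
    have fd := fun j => congrArg (diagCoord j) f
    simp only [diagCoord_jordan_diag, offCoord_jordan_diag, map_zero] at ed eo fd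
    apply H3.ext_coord
    · intro j
      rw [diagCoord_off]
      rcases fin3_cases i j with rfl | rfl | rfl
      · have := ed j
        rw [Pi.single_eq_same] at this
        linarith
      · have := fd (i + 1)
        rw [Pi.single_eq_same] at this
        linarith
      · have := fd (i + 2)
        rw [h4] at this
        linarith
    · intro j
      rcases fin3_cases i j with rfl | rfl | rfl
      · rw [offCoord_off_self]
      · have := eo (i + 1)
        rw [fin3_add_one_add_one, fin3_add_one_add_two, h2, Pi.single_eq_same, zero_add,
          one_smul] at this
        rw [← this, offCoord_off_of_ne (by omega)]
      · have := eo (i + 2)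
        rw [fin3_add_two_add_one, fin3_add_two_add_two, h1, Pi.single_eq_same, add_zero,
          one_smul] at this
        rw [← this, offCoord_off_of_ne (by omega)]
  have ht : ∀ i x, D (off i x) = off i ((offCoord i ∘ₗ D ∘ₗ off i) x) := h1
  obtain ⟨T, hT⟩ := exists_tri (fun i => offCoord i ∘ₗ D ∘ₗ off i) (by
    intro i x y
    obtain ⟨_, _, _, h4, _, _⟩ := fin3_single i 1
    have := congrArg (diagCoord (i + 1)) (hD' (off i x) (off i y))
    rw [jordan_off_self, map_smul, h0, ht, ht, jordan_off_self, jordan_off_self] at this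
    simp only [smul_zero, map_zero, map_add, map_smul, diagCoord_diag, Pi.single_eq_same,
      smul_eq_mul] at this
    have h6 : (Pi.single (i + 2) 1 : Fin 3 → ℝ) (i + 1) = 0 := (fin3_single i 1).2.2.2.2.2
    rw [h6] at this
    linarith) (by
    intro x y
    have := congrArg (offCoord 0) (hD' (off 1 x) (off 2 y))
    have e : ∀ x y : K, jordan K (off 1 x) (off 2 y) = off 0 (conj K y * conj K x) :=
      jordan_off_succ 1
    rw [e, ht, ht, ht, e, e, map_add, offCoord_off_self, offCoord_off_self, offCoord_off_self,
      add_comm] at this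
    rw [this, add_comm])
  refine ⟨T, H3.hom_ext (fun α => ?_) (fun i x => ?_)⟩
  · rw [h0, derT_diag]
  · rw [derT_off, hT, ht]

theorem exists_derT_add_dOff {D : Module.End ℝ (H3 K)} (hD : D ∈ Der (jordan K)) :
    ∃ (T : Tri K) (x : Fin 3 → K), D = derT K T + ∑ i, dOff i (x i) := by
  -- The sign is forced by `dOff i x e_{i+1} = -off i x`: subtracting these `dOff` leaves a
  -- derivation that kills the diagonal.
  let x : Fin 3 → K := fun i => -offCoord i (D (diag K (Pi.single (i + 1) 1)))
  have hmem : D - ∑ i, dOff i (x i) ∈ Der (jordan K) :=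
    sub_mem hD (sum_mem fun i _ => dOff_mem i (x i))
  obtain ⟨T, hT⟩ := exists_derT_of_diag hmem (by
    intro α
    rw [LinearMap.sub_apply, derivation_diag hD, LinearMap.sum_apply, ← Finset.sum_sub_distrib]
    refine Finset.sum_eq_zero fun i _ => ?_
    rw [dOff_diag]
    simp only [x, map_neg]
    module)
  exact ⟨T, x, by rw [← hT, sub_add_cancel]⟩

end Classification

/-! ### Symmetry of the constituents of the Tits bracket -/

section TensorForms

/-- Used with signs `s`, `t` of opposite kind: in each term of the Tits bracket one factor is
symmetric and the other skew, so the term is skew. -/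
theorem map₂_swap {M N P Q : Type*} [AddCommGroup M] [Module ℝ M] [AddCommGroup N] [Module ℝ N]
    [AddCommGroup P] [Module ℝ P] [AddCommGroup Q] [Module ℝ Q]
    {f : M →ₗ[ℝ] M →ₗ[ℝ] P} {g : N →ₗ[ℝ] N →ₗ[ℝ] Q} {s t : ℝ}
    (hf : ∀ x y, f x y = s • f y x) (hg : ∀ x y, g x y = t • g y x) (u v : M ⊗[ℝ] N) :
    TensorProduct.map₂ f g u v = (s * t) • TensorProduct.map₂ f g v u := by
  induction u with
  | zero => simp
  | add u u' hu hu' => simp only [map_add, LinearMap.add_apply, hu, hu', smul_add]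
  | tmul x a =>
    induction v with
    | zero => simp
    | add v v' hv hv' => simp only [map_add, LinearMap.add_apply, hv, hv', smul_add]
    | tmul y b =>
      rw [TensorProduct.map₂_apply_tmul, TensorProduct.map₂_apply_tmul, TensorProduct.map_tmul,
        TensorProduct.map_tmul, hf, hg, TensorProduct.smul_tmul_smul]

end TensorForms

section FormH

variable {K : Type*} [NonAssocRing K] [Module ℝ K] [IsScalarTower ℝ K K] [SMulCommClass ℝ K K]
  [CompositionAlgebra K]

/-- `K = ℝ 1 ⊕ K'`. The embedding of `F_i(x ⊗ y)` has different shapes for `y = 1` and for `y`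
imaginary, so the bracket formulas are proved by this split. -/
theorem im_induction {p : K → Prop} (one : p 1) (im : ∀ a, form K a 1 = 0 → p a)
    (add : ∀ x y, p x → p y → p (x + y)) (smul : ∀ (r : ℝ) x, p x → p (r • x)) (x : K) : p x := by
  have h : x = form K x 1 • (1 : K) + (x - form K x 1 • (1 : K)) := by abel
  rw [h]
  refine add _ _ (smul _ _ one) (im _ ?_)
  simp [form_one_one]

theorem tr_diag (α : Fin 3 → ℝ) : tr K (diag K α) = (∑ i, α i) • (1 : K) := by
  change Matrix.trace (diag K α).val = _
  rw [diag_val, Matrix.trace_diagonal, Finset.sum_smul]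

theorem tr_off (i : Fin 3) (x : K) : tr K (off i x) = 0 := by
  change Matrix.trace (off i x).val = _
  rw [off_val, Matrix.trace_add, Matrix.trace_single_eq_of_ne _ _ _ (by omega),
    Matrix.trace_single_eq_of_ne _ _ _ (by omega), add_zero]

theorem formH_apply (A B : H3 K) : formH K A B = form K (tr K (jordan K A B)) 1 := rfl

theorem formH_comm (A B : H3 K) : formH K A B = formH K B A := by
  rw [formH_apply, formH_apply, jordan_comm]

theorem jstar_apply (A B : H3 K) :
    jstar K A B = jordan K A B - ((1 / 3 : ℝ) * formH K A B) • diag K 1 := by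
  have h : H3.mk 1 one_mem_hermitian = diag K 1 := by
    apply H3.ext
    rw [H3.val_mk, diag_val]
    simp
  change jordan K A B - (1 / 3 : ℝ) • (formH K A B • H3.mk 1 one_mem_hermitian) = _
  rw [h, smul_smul]

theorem jstar_comm (A B : H3 K) : jstar K A B = jstar K B A := by
  rw [jstar_apply, jstar_apply, jordan_comm, formH_comm]

theorem derK_swap (x y : K) : derK x y = - derK y x := by
  ext z
  rw [LinearMap.neg_apply, derK_apply, derK_apply, associator_self_left y]
  simp only [sub_mul, mul_sub]
  module

theorem formH_diag_diag (α β : Fin 3 → ℝ) :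
    formH K (diag K α) (diag K β) = 2 * ∑ i, α i * β i := by
  simp [formH_apply, tr_diag, form_one_one]

theorem formH_diag_off (α : Fin 3 → ℝ) (i : Fin 3) (x : K) :
    formH K (diag K α) (off i x) = 0 := by
  simp [formH_apply, tr_off]

theorem formH_off_self (i : Fin 3) (x y : K) :
    formH K (off i x) (off i y) = 4 * form K x y := by
  rw [formH_apply, jordan_off_self, map_smul, tr_diag]
  simp [form_one_one, Finset.sum_add_distrib]
  ring

theorem formH_off_succ (i : Fin 3) (x y : K) : formH K (off i x) (off (i + 1) y) = 0 := by
  simp [formH_apply, tr_off]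

theorem diag_one (i : Fin 3) : diag K 1 = diag K (Pi.single i 1) +
    diag K (Pi.single (i + 1) 1) + diag K (Pi.single (i + 2) 1) := by
  rw [← map_add, ← map_add]
  congr 1
  ext j
  fin_cases i <;> fin_cases j <;> simp

end FormH

/-! ### The Tits bracket as a bilinear map, and the embeddings of the summands -/

section Bilinear

variable {K₁ : Type*} [NonAssocRing K₁] [Module ℝ K₁] [IsScalarTower ℝ K₁ K₁]
  [SMulCommClass ℝ K₁ K₁] [CompositionAlgebra K₁]
variable {K₂ : Type*} [NonAssocRing K₂] [Module ℝ K₂] [IsScalarTower ℝ K₂ K₂]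
  [SMulCommClass ℝ K₂ K₂] [CompositionAlgebra K₂]

theorem tits_swap (u v : Ambient K₁ K₂) : tits v u = - tits u v := by
  have h1 := map₂_swap (f := lieL (jordan K₁)) (g := form K₂) (s := -1) (t := 1)
    (fun x y => by rw [neg_one_smul, ← lieL_swap]) (fun x y => by rw [one_smul, form_symm])
    v.2.1 u.2.1
  have h2 := map₂_swap (f := jstar K₁) (g := halfComm (K := K₂)) (s := 1) (t := -1)
    (fun x y => by rw [one_smul, jstar_comm])
    (fun x y => by rw [halfComm_apply, halfComm_apply]; module) v.2.1 u.2.1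
  have h3 := map₂_swap (f := formH K₁) (g := derK (K := K₂)) (s := 1) (t := -1)
    (fun x y => by rw [one_smul, formH_comm]) (fun x y => by rw [neg_one_smul, ← derK_swap])
    v.2.1 u.2.1
  simp only [tits, h1, h2, h3, ← lie_skew v.1 u.1, ← lie_skew v.2.2 u.2.2, map_smul, Prod.neg_mk]
  refine Prod.ext ?_ (Prod.ext ?_ ?_)
  · module
  · module
  · module

/-- The bracket of Tits as a bilinear map. -/
def titsHom : Ambient K₁ K₂ →ₗ[ℝ] Ambient K₁ K₂ →ₗ[ℝ] Ambient K₁ K₂ :=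
  have add : ∀ u v w : Ambient K₁ K₂, tits (u + v) w = tits u w + tits v w := by
    intro u v w
    simp only [tits, Prod.fst_add, Prod.snd_add, map_add, LinearMap.add_apply, add_lie, smul_add,
      LinearMap.rTensor_add, LinearMap.lTensor_add]
    refine Prod.ext ?_ (Prod.ext ?_ ?_) <;> simp only [Prod.fst_add, Prod.snd_add] <;> abel
  have smul : ∀ (c : ℝ) (u w : Ambient K₁ K₂), tits (c • u) w = c • tits u w := by
    intro c u w
    simp only [tits, Prod.smul_fst, Prod.smul_snd, map_smul, LinearMap.smul_apply, smul_lie,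
      LinearMap.rTensor_smul, LinearMap.lTensor_smul]
    refine Prod.ext ?_ (Prod.ext ?_ ?_) <;> simp only [Prod.smul_fst, Prod.smul_snd] <;> module
  LinearMap.mk₂ ℝ tits add smul
    (fun u v w => by rw [tits_swap, add, neg_add, ← tits_swap, ← tits_swap])
    (fun c u w => by rw [tits_swap, smul, ← smul_neg, ← tits_swap])

theorem titsHom_apply (u v : Ambient K₁ K₂) : titsHom u v = tits u v := rfl

theorem tits_fst_fst (D D' : Module.End ℝ (H3 K₁)) :
    tits ((D, 0, 0) : Ambient K₁ K₂) (D', 0, 0) = (⁅D, D'⁆, 0, 0) := by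
  simp [tits]

theorem tits_fst_mid (D : Module.End ℝ (H3 K₁)) (t : H3 K₁ ⊗[ℝ] K₂) :
    tits ((D, 0, 0) : Ambient K₁ K₂) (0, t, 0) = (0, LinearMap.rTensor K₂ D t, 0) := by
  simp [tits]

theorem tits_fst_snd (D : Module.End ℝ (H3 K₁)) (E : Module.End ℝ K₂) :
    tits ((D, 0, 0) : Ambient K₁ K₂) (0, 0, E) = 0 := by
  simp [tits]

theorem tits_snd_mid (E : Module.End ℝ K₂) (t : H3 K₁ ⊗[ℝ] K₂) :
    tits ((0, 0, E) : Ambient K₁ K₂) (0, t, 0) = (0, LinearMap.lTensor (H3 K₁) E t, 0) := by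
  simp [tits]

variable (K₁ K₂) in
/-- The embedding of `Tri K₁`. -/
def phiT : Tri K₁ →ₗ[ℝ] Ambient K₁ K₂ := LinearMap.inl ℝ _ _ ∘ₗ derT K₁

variable (K₁ K₂) in
/-- The embedding of `Tri K₂`. -/
def phiU : Tri K₂ →ₗ[ℝ] Ambient K₁ K₂ :=
  LinearMap.inr ℝ _ _ ∘ₗ
    (∑ i, TensorProduct.mk ℝ (H3 K₁) K₂ (diag K₁ (Pi.single i 1)) ∘ₗ triVec i).prod (triDer K₂)

variable (K₁ K₂) in
/-- The embedding of the `i`-th copy of `K₁ ⊗ K₂`. -/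
def phiF (i : Fin 3) : K₁ ⊗[ℝ] K₂ →ₗ[ℝ] Ambient K₁ K₂ :=
  -((dOff i ∘ₗ (TensorProduct.rid ℝ K₁).toLinearMap ∘ₗ
      LinearMap.lTensor K₁ ((form K₂).flip 1)).prod
    ((TensorProduct.map (off i)
      (LinearMap.id - ((form K₂).flip 1).smulRight (1 : K₂))).prod 0) :
    K₁ ⊗[ℝ] K₂ →ₗ[ℝ] Ambient K₁ K₂)

theorem phiT_apply (T : Tri K₁) : phiT K₁ K₂ T = (derT K₁ T, 0, 0) := rfl

theorem phiU_apply (T : Tri K₂) : phiU K₁ K₂ T =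
    (0, ∑ i, diag K₁ (Pi.single i 1) ⊗ₜ triVec i T, triDer K₂ T) := by
  simp [phiU]

theorem phiU_eq (T : Tri K₂) : phiU K₁ K₂ T =
    ∑ i, (0, diag K₁ (Pi.single i 1) ⊗ₜ triVec i T, 0) + (0, 0, triDer K₂ T) := by
  rw [phiU_apply, Fin.sum_univ_three, Fin.sum_univ_three]
  simp

theorem phiF_one (i : Fin 3) (x : K₁) : phiF K₁ K₂ i (x ⊗ₜ 1) = (-dOff i x, 0, 0) := by
  simp [phiF, form_one_one]

theorem phiF_im (i : Fin 3) (x : K₁) {a : K₂} (ha : form K₂ a 1 = 0) :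
    phiF K₁ K₂ i (x ⊗ₜ a) = (0, -(off i x ⊗ₜ a), 0) := by
  simp [phiF, ha]

theorem tits_phiT_phiT (S T : Tri K₁) :
    tits (phiT K₁ K₂ S) (phiT K₁ K₂ T) = phiT K₁ K₂ ⁅S, T⁆ := by
  rw [phiT_apply, phiT_apply, phiT_apply, tits_fst_fst, derT_lie]

/-- The image of `U` uses only diagonal matrices and Der K₂, and the derivation attached to `T`
kills the former and commutes with the latter. -/
theorem tits_phiT_phiU (T : Tri K₁) (U : Tri K₂) :
    tits (phiT K₁ K₂ T) (phiU K₁ K₂ U) = 0 := by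
  rw [phiT_apply, phiU_eq, ← titsHom_apply, map_add, map_sum]
  simp only [titsHom_apply, tits_fst_mid, tits_fst_snd, LinearMap.rTensor_tmul, derT_diag,
    TensorProduct.zero_tmul]
  simp

theorem jstar_single (i j : Fin 3) :
    jstar K₁ (diag K₁ (Pi.single i 1)) (diag K₁ (Pi.single j 1)) =
      if i = j then (2 : ℝ) • diag K₁ (Pi.single i 1) - (2 / 3 : ℝ) • diag K₁ 1 else 0 := by
  rw [jstar_apply, jordan_diag_diag, formH_diag_diag]
  split_ifs with h
  · subst h
    simp only [single_mul_eq, Pi.single_eq_same, one_smul, Pi.single_apply]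
    simp
    norm_num
  · rw [single_mul_eq, Pi.single_eq_of_ne' h]
    simp [Pi.single_apply, Ne.symm h]

/-- Term by term this is `triVec_lie_triDer_lie`; the term in Der H₃(K₁) vanishes because diagonal
multiplications commute. -/
theorem tits_phiU_phiU (S T : Tri K₂) :
    tits (phiU K₁ K₂ S) (phiU K₁ K₂ T) = phiU K₁ K₂ ⁅S, T⁆ := by
  obtain ⟨h1, h2⟩ := triVec_lie_triDer_lie S T
  rw [phiU_apply, phiU_apply, phiU_apply, h2]
  simp only [h1, tits]
  refine Prod.ext ?_ (Prod.ext ?_ ?_)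
  · simp [lieL_diag_diag]
  · simp only [Fin.sum_univ_three, map_add, LinearMap.add_apply, TensorProduct.map₂_apply_tmul,
      TensorProduct.map_tmul, jstar_single, LinearMap.rTensor_zero, LinearMap.zero_apply,
      LinearMap.lTensor_tmul, diag_one (0 : Fin 3)]
    simp only [Fin.isValue, reduceIte, Fin.reduceEq, Fin.reduceAdd, TensorProduct.zero_tmul,
      TensorProduct.sub_tmul, TensorProduct.add_tmul, TensorProduct.tmul_add,
      TensorProduct.tmul_sub, ← TensorProduct.smul_tmul', TensorProduct.tmul_smul, smul_add]
    module
  · simp only [Fin.sum_univ_three, map_add, LinearMap.add_apply, TensorProduct.map₂_apply_tmul,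
      TensorProduct.map_tmul, formH_diag_diag, TensorProduct.lid_tmul, Pi.single_apply]
    simp only [Fin.isValue, reduceIte, Fin.reduceEq]
    module

end Bilinear

theorem halfComm_swap {R : Type*} [NonAssocRing R] [Module ℝ R] [IsScalarTower ℝ R R]
    [SMulCommClass ℝ R R] (a b : R) : halfComm a b = - halfComm b a := by
  rw [halfComm_apply, halfComm_apply]
  module

/-! ### The shifted trialities as a bilinear function -/

section TxyHom

variable {K : Type*} [NonAssocRing K] [Module ℝ K] [IsScalarTower ℝ K K] [SMulCommClass ℝ K K]
  [CompositionAlgebra K]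

theorem comp_Txy (x y z : K) (j : Fin 3) : Tri.comp (Txy x y) j z =
    ![(4 * form K x z) • y - (4 * form K y z) • x, conj K y * (x * z) - conj K x * (y * z),
      (z * x) * conj K y - (z * y) * conj K x] j := by
  fin_cases j
  · exact comp_Txy_zero x y z
  · exact comp_Txy_one x y z
  · exact comp_Txy_two x y z

theorem Tri.ext_comp_theta_symm {S T : Tri K} (i : Fin 3)
    (h : ∀ j, Tri.comp S (i + j) = Tri.comp T (i + j)) : S = T := by
  apply Tri.ext_comp
  intro k
  have := h (k - i)
  rwa [add_sub_cancel] at this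

/-- The bilinear map `(x, y) ↦ θ ^ (-i) T_{x,y}`. -/
def thetaTxy (i : Fin 3) : K →ₗ[ℝ] K →ₗ[ℝ] Tri K :=
  LinearMap.mk₂ ℝ (fun x y => (⇑(theta K).symm)^[(i : ℕ)] (Txy x y))
    (by
      intro x x' y
      refine Tri.ext_comp_theta_symm i fun j => LinearMap.ext fun z => ?_
      rw [Tri.comp_add, LinearMap.add_apply]
      simp only [comp_theta_symm_iterate, comp_Txy]
      fin_cases j
      · simp
        module
      · simp [mul_add, add_mul]
        abel
      · simp [mul_add, add_mul]
        abel)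
    (by
      intro c x y
      refine Tri.ext_comp_theta_symm i fun j => LinearMap.ext fun z => ?_
      rw [Tri.comp_smul, LinearMap.smul_apply]
      simp only [comp_theta_symm_iterate, comp_Txy]
      fin_cases j
      · simp
        module
      · simp [smul_sub, smul_mul_assoc, mul_smul_comm]
      · simp [smul_sub, smul_mul_assoc, mul_smul_comm])
    (by
      intro x y y'
      refine Tri.ext_comp_theta_symm i fun j => LinearMap.ext fun z => ?_
      rw [Tri.comp_add, LinearMap.add_apply]
      simp only [comp_theta_symm_iterate, comp_Txy]
      fin_cases j
      · simp
        module
      · simp [mul_add, add_mul]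
        abel
      · simp [mul_add, add_mul]
        abel)
    (by
      intro c x y
      refine Tri.ext_comp_theta_symm i fun j => LinearMap.ext fun z => ?_
      rw [Tri.comp_smul, LinearMap.smul_apply]
      simp only [comp_theta_symm_iterate, comp_Txy]
      fin_cases j
      · simp
        module
      · simp [smul_sub, smul_mul_assoc, mul_smul_comm]
      · simp [smul_sub, smul_mul_assoc, mul_smul_comm])

theorem thetaTxy_apply (i : Fin 3) (x y : K) :
    thetaTxy i x y = (⇑(theta K).symm)^[(i : ℕ)] (Txy x y) := rfl

theorem thetaTxy_self (i : Fin 3) (x : K) : thetaTxy i x x = 0 := by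
  refine Tri.ext_comp_theta_symm i fun j => LinearMap.ext fun z => ?_
  -- Writing `0` as `0 • 0` lets the linearity of `Tri.comp` show that the components of the zero
  -- triality vanish.
  rw [← zero_smul ℝ (0 : Tri K), Tri.comp_smul, zero_smul, thetaTxy_apply,
    comp_theta_symm_iterate, comp_Txy]
  fin_cases j <;> simp

theorem thetaTxy_swap (i : Fin 3) (x y : K) : thetaTxy i y x = - thetaTxy i x y := by
  have h := thetaTxy_self i (x + y)
  simp only [map_add, LinearMap.add_apply, thetaTxy_self, zero_add, add_zero] at h
  exact eq_neg_of_add_eq_zero_left h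

theorem triVec_thetaTxy (i j : Fin 3) (x y : K) :
    triVec (i + j) (thetaTxy i x y) = triVec j (Txy x y) :=
  triVec_theta_symm_iterate _ _ _

theorem triVec_thetaTxy_self (i : Fin 3) (x y : K) :
    triVec i (thetaTxy i x y) = triVec 0 (Txy x y) := by
  rw [← triVec_thetaTxy i, add_zero]

theorem triDer_thetaTxy (i : Fin 3) (x y : K) :
    triDer K (thetaTxy i x y) = triDer K (Txy x y) :=
  triDer_theta_symm_iterate _ _

theorem mul_eq_halfComm_sub {a b : K} (ha : form K a 1 = 0) (hb : form K b 1 = 0) :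
    a * b = halfComm a b - form K a b • (1 : K) := by
  have h := mul_add_mul_comm a b
  rw [ha, hb] at h
  rw [halfComm_apply]
  linear_combination (norm := module) (1 / 2 : ℝ) • h

theorem form_halfComm_one {a : K} (ha : form K a 1 = 0) (b : K) :
    form K (halfComm a b) 1 = 0 := by
  rw [halfComm_apply, map_smul, map_sub, LinearMap.smul_apply, LinearMap.sub_apply,
    form_left, form_right, conj_eq_neg_iff.2 ha, mul_one, one_mul, sub_self, smul_zero]

end TxyHom

/-! ### The brackets involving the copies of K₁ ⊗ K₂ -/

section Brackets

variable {K₁ : Type*} [NonAssocRing K₁] [Module ℝ K₁] [IsScalarTower ℝ K₁ K₁]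
  [SMulCommClass ℝ K₁ K₁] [CompositionAlgebra K₁]
variable {K₂ : Type*} [NonAssocRing K₂] [Module ℝ K₂] [IsScalarTower ℝ K₂ K₂]
  [SMulCommClass ℝ K₂ K₂] [CompositionAlgebra K₂]

theorem tits_phiT_phiF (T : Tri K₁) (i : Fin 3) (x : K₁) (y : K₂) :
    tits (phiT K₁ K₂ T) (phiF K₁ K₂ i (x ⊗ₜ y)) = phiF K₁ K₂ i (Tri.comp T i x ⊗ₜ y) := by
  simp only [← titsHom_apply]
  induction y using im_induction with
  | one => rw [phiF_one, phiF_one, phiT_apply, titsHom_apply, tits_fst_fst, lie_neg, lie_derT_dOff]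
  | im a ha =>
    rw [phiF_im _ _ ha, phiF_im _ _ ha, phiT_apply, titsHom_apply, tits_fst_mid, map_neg,
      LinearMap.rTensor_tmul, derT_off]
  | add y y' hy hy' => simp only [TensorProduct.tmul_add, map_add, hy, hy']
  | smul r y hy => simp only [TensorProduct.tmul_smul, map_smul, hy]

theorem jstar_single_off (m i : Fin 3) (x : K₁) :
    jstar K₁ (diag K₁ (Pi.single m 1)) (off i x) = (if m = i then (0 : ℝ) else 1) • off i x := by
  rw [jstar_apply, jordan_diag_off, formH_diag_off]
  have h : (Pi.single m 1 : Fin 3 → ℝ) (i + 1) + (Pi.single m 1 : Fin 3 → ℝ) (i + 2) =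
      if m = i then (0 : ℝ) else 1 := by
    fin_cases m <;> fin_cases i <;> simp
  rw [h]
  module

/-- For `y = 1`, `dOff i x` sees only `e_{i+1}` and `e_{i+2}`, with opposite signs, which gives `U_i
1 = a_{i+1} - a_{i+2}`. For imaginary `y` all three terms of the Tits bracket are compared with the
real and imaginary parts of `U_i y`. -/
theorem tits_phiU_phiF (U : Tri K₂) (i : Fin 3) (x : K₁) (y : K₂) :
    tits (phiU K₁ K₂ U) (phiF K₁ K₂ i (x ⊗ₜ y)) = phiF K₁ K₂ i (x ⊗ₜ Tri.comp U i y) := by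
  obtain ⟨h1, h2, h3, h4, h5, h6⟩ := fin3_single i 1
  simp only [← titsHom_apply]
  induction y using im_induction with
  | one =>
    rw [phiF_one, phiF_im _ _ (form_comp_one U i), ← triVec_sub, titsHom_apply, tits_swap, phiU_eq,
      ← titsHom_apply, map_add, map_sum, fin3_sum i]
    simp only [titsHom_apply, tits_fst_mid, tits_fst_snd, LinearMap.rTensor_tmul,
      LinearMap.neg_apply, dOff_diag, h1, h2, h4, h6, Pi.single_eq_same]
    refine Prod.ext (by simp) (Prod.ext ?_ (by simp))
    simp only [Prod.snd_neg, Prod.fst_neg, Prod.snd_add, Prod.fst_add, Prod.snd_zero,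
      Prod.fst_zero, TensorProduct.tmul_sub, TensorProduct.neg_tmul, ← TensorProduct.smul_tmul']
    module
  | im b hb =>
    have ha := form_triVec_one U
    have hD : form K₂ (triDer K₂ U b) 1 = 0 := by
      rw [derivation_skew (triDer_mul U), derivation_one (triDer_mul U), map_zero, neg_zero]
    -- The product of two imaginary elements is half their commutator minus their form. The real
    -- part goes to `dOff` and the imaginary part to `off i`.
    have e : Tri.comp U i b = (triDer K₂ U b + halfComm (triVec (i + 1) U) b +
        halfComm (triVec (i + 2) U) b) +
        (form K₂ (triVec (i + 2) U) b - form K₂ (triVec (i + 1) U) b) • (1 : K₂) := by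
      rw [comp_eq U i]
      simp only [LinearMap.add_apply, LinearMap.sub_apply, LinearMap.mulLeft_apply,
        LinearMap.mulRight_apply]
      rw [mul_eq_halfComm_sub (ha _) hb, mul_eq_halfComm_sub hb (ha _), halfComm_swap b,
        form_symm b]
      module
    have hI : form K₂ (triDer K₂ U b + halfComm (triVec (i + 1) U) b +
        halfComm (triVec (i + 2) U) b) 1 = 0 := by
      rw [map_add, map_add, LinearMap.add_apply, LinearMap.add_apply, hD,
        form_halfComm_one (ha _), form_halfComm_one (ha _), add_zero, add_zero]
    have n1 : i + 1 ≠ i := by omega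
    have n2 : i + 2 ≠ i := by omega
    rw [e, TensorProduct.tmul_add, map_add, TensorProduct.tmul_smul, map_smul, phiF_one,
      phiF_im _ _ hI, phiF_im _ _ hb, phiU_eq, map_add,
      map_sum, fin3_sum i]
    simp only [LinearMap.add_apply, titsHom_apply, tits_snd_mid, ← TensorProduct.neg_tmul, ← map_neg,
      tits_tmul, lieL_diag_off, jstar_single_off, formH_diag_off, LinearMap.lTensor_tmul, h1, h2, h4,
      h6, Pi.single_eq_same, if_neg n1, if_neg n2, reduceIte]
    refine Prod.ext ?_ (Prod.ext ?_ (by simp))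
    · simp
      module
    · simp [TensorProduct.tmul_add, TensorProduct.neg_tmul]
      module
  | add y y' hy hy' => simp only [TensorProduct.tmul_add, map_add, hy, hy']
  | smul r y hy => simp only [TensorProduct.tmul_smul, map_smul, hy]

/-- When both second factors are imaginary, `b a = -½[a,b] - ⟨a,b⟩1`: the commutator arises from the
Jordan product and the scalar from `[L_A, L_B]`. There is no Der K₂ term since the matrices are
orthogonal. -/
theorem tits_phiF_phiF_succ (i : Fin 3) (x₁ y₁ : K₁) (x₂ y₂ : K₂) :
    tits (phiF K₁ K₂ i (x₁ ⊗ₜ x₂)) (phiF K₁ K₂ (i + 1) (y₁ ⊗ₜ y₂)) =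
      phiF K₁ K₂ (i + 2) ((conj K₁ y₁ * conj K₁ x₁) ⊗ₜ (conj K₂ y₂ * conj K₂ x₂)) := by
  simp only [← titsHom_apply]
  induction x₂ using im_induction with
  | one =>
    rw [conj_one, mul_one, phiF_one]
    induction y₂ using im_induction with
    | one =>
      rw [conj_one, phiF_one, phiF_one, titsHom_apply, tits_fst_fst, neg_lie, lie_neg, neg_neg,
        lie_dOff_succ]
    | im b hb =>
      rw [conj_eq_neg_iff.2 hb, TensorProduct.tmul_neg, map_neg, phiF_im _ _ hb, phiF_im _ _ hb,
        titsHom_apply, tits_fst_mid, map_neg, LinearMap.rTensor_tmul, LinearMap.neg_apply,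
        dOff_off_succ]
      simp [TensorProduct.neg_tmul]
    | add y y' hy hy' => simp only [TensorProduct.tmul_add, map_add, hy, hy']
    | smul r y hy => simp only [TensorProduct.tmul_smul, map_smul, hy]
  | im a ha =>
    rw [conj_eq_neg_iff.2 ha, phiF_im _ _ ha]
    induction y₂ using im_induction with
    | one =>
      have h := dOff_off_succ_succ (i + 1) y₁ x₁
      rw [fin3_add_one_add_one, fin3_add_one_add_two] at h
      rw [conj_one, one_mul, TensorProduct.tmul_neg, map_neg, phiF_one, phiF_im _ _ ha,
        titsHom_apply, tits_swap, tits_fst_mid, map_neg, LinearMap.rTensor_tmul,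
        LinearMap.neg_apply, h]
      simp
    | im b hb =>
      have e : -b * -a = -halfComm a b + -(form K₂ a b • (1 : K₂)) := by
        rw [neg_mul_neg, mul_eq_halfComm_sub hb ha, halfComm_swap, form_symm]
        abel
      rw [conj_eq_neg_iff.2 hb, phiF_im _ _ hb, e, TensorProduct.tmul_add, map_add,
        TensorProduct.tmul_neg, map_neg, phiF_im _ _ (form_halfComm_one ha b),
        TensorProduct.tmul_neg, map_neg, TensorProduct.tmul_smul, map_smul, phiF_one,
        titsHom_apply, ← TensorProduct.neg_tmul, ← TensorProduct.neg_tmul, ← map_neg, ← map_neg,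
        tits_tmul, lieL_off_succ, formH_off_succ, jstar_apply, jordan_off_succ, formH_off_succ]
      simp
    | add y y' hy hy' =>
      simp only [TensorProduct.tmul_add, map_add, hy, hy', add_mul]
    | smul r y hy => simp only [TensorProduct.tmul_smul, map_smul, hy, smul_mul_assoc]
  | add x x' hx hx' =>
    simp only [TensorProduct.tmul_add, map_add, LinearMap.add_apply, hx, hx', mul_add]
  | smul r x hx =>
    simp only [TensorProduct.tmul_smul, map_smul, LinearMap.smul_apply, hx, mul_smul_comm]

theorem tits_phiF_one_phiF_im (i : Fin 3) (x y : K₁) {b : K₂} (hb : form K₂ b 1 = 0) :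
    tits (phiF K₁ K₂ i (x ⊗ₜ 1)) (phiF K₁ K₂ i (y ⊗ₜ b)) =
      phiU K₁ K₂ (form K₁ x y • thetaTxy i 1 b) := by
  obtain ⟨e0, e1, e2, e3⟩ := triVec_Txy_one hb
  rw [phiF_one, phiF_im _ _ hb, tits_fst_mid, map_smul, phiU_apply, fin3_sum i, triDer_thetaTxy,
    triVec_thetaTxy_self, triVec_thetaTxy, triVec_thetaTxy, e0, e1, e2, e3, map_neg,
    LinearMap.rTensor_tmul, LinearMap.neg_apply, dOff_off_self]
  refine Prod.ext (by simp) (Prod.ext ?_ (by simp))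
  simp only [Prod.smul_snd, Prod.smul_fst, map_sub, TensorProduct.tmul_neg,
    TensorProduct.tmul_smul, TensorProduct.tmul_zero, TensorProduct.neg_tmul, neg_neg,
    ← TensorProduct.smul_tmul', TensorProduct.sub_tmul]
  module

/-- The term `-⟨a,b⟩[L_A, L_B]` is the triality of `K₁`; the other two terms assemble the triality
of `K₂` through its pair `(D, a)` in `triVec_Txy`. -/
theorem tits_phiF_im_phiF_im (i : Fin 3) (x y : K₁) {a b : K₂} (ha : form K₂ a 1 = 0)
    (hb : form K₂ b 1 = 0) :
    tits (phiF K₁ K₂ i (x ⊗ₜ a)) (phiF K₁ K₂ i (y ⊗ₜ b)) =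
      phiT K₁ K₂ (form K₂ a b • thetaTxy i x y) + phiU K₁ K₂ (form K₁ x y • thetaTxy i a b) := by
  obtain ⟨e0, e1, e2, e3⟩ := triVec_Txy ha hb
  rw [phiF_im _ _ ha, phiF_im _ _ hb, map_smul, map_smul, phiT_apply, phiU_apply, fin3_sum i,
    triDer_thetaTxy, triVec_thetaTxy_self, triVec_thetaTxy, triVec_thetaTxy, e0, e1, e2, e3,
    ← TensorProduct.neg_tmul, ← TensorProduct.neg_tmul, tits_tmul]
  simp only [map_neg, LinearMap.neg_apply, neg_neg]
  rw [lieL_off_self, jstar_apply, formH_off_self, jordan_off_self, diag_one i, map_add]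
  refine Prod.ext ?_ (Prod.ext ?_ ?_)
  · simp [thetaTxy_apply]
  · simp only [Prod.snd_add, Prod.fst_add, Prod.smul_snd, Prod.smul_fst, smul_zero, zero_add,
      TensorProduct.tmul_smul, TensorProduct.add_tmul, TensorProduct.sub_tmul,
      ← TensorProduct.smul_tmul']
    module
  · simp [smul_smul]
    module

theorem tits_phiF_phiF_self (i : Fin 3) (x₁ y₁ : K₁) (x₂ y₂ : K₂) :
    tits (phiF K₁ K₂ i (x₁ ⊗ₜ x₂)) (phiF K₁ K₂ i (y₁ ⊗ₜ y₂)) =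
      phiT K₁ K₂ (form K₂ x₂ y₂ • thetaTxy i x₁ y₁) +
        phiU K₁ K₂ (form K₁ x₁ y₁ • thetaTxy i x₂ y₂) := by
  simp only [← titsHom_apply]
  induction x₂ using im_induction with
  | one =>
    induction y₂ using im_induction with
    | one =>
      rw [phiF_one, phiF_one, thetaTxy_self, form_one_one, one_smul, smul_zero, map_zero, add_zero,
        titsHom_apply, tits_fst_fst, neg_lie, lie_neg, neg_neg, lie_dOff_self]
      rfl
    | im b hb =>
      rw [titsHom_apply, tits_phiF_one_phiF_im _ _ _ hb, form_symm 1 b, hb, zero_smul, map_zero,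
        zero_add]
    | add y y' hy hy' =>
      simp only [TensorProduct.tmul_add, map_add, hy, hy', add_smul, smul_add]
      abel
    | smul r y hy =>
      simp only [TensorProduct.tmul_smul, map_smul, hy, smul_eq_mul, mul_smul]
      module
  | im a ha =>
    induction y₂ using im_induction with
    | one =>
      rw [titsHom_apply, tits_swap, tits_phiF_one_phiF_im _ _ _ ha, ha, zero_smul, map_zero,
        zero_add, thetaTxy_swap i a 1, form_symm x₁, smul_neg, map_neg, neg_neg]
    | im b hb =>
      exact tits_phiF_im_phiF_im i x₁ y₁ ha hb
    | add y y' hy hy' =>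
      simp only [TensorProduct.tmul_add, map_add, hy, hy', add_smul, smul_add]
      abel
    | smul r y hy =>
      simp only [TensorProduct.tmul_smul, map_smul, hy, smul_eq_mul, mul_smul]
      module
  | add x x' hx hx' =>
    simp only [TensorProduct.tmul_add, map_add, LinearMap.add_apply, hx, hx', add_smul, smul_add]
    abel
  | smul r x hx =>
    simp only [TensorProduct.tmul_smul, map_smul, LinearMap.smul_apply, hx, smul_eq_mul, mul_smul]
    module

end Brackets

/-! ### The identification with L₃(K₁, K₂) and the exchange of the algebras -/

section Iso

variable (K₁ : Type*) [NonAssocRing K₁] [Module ℝ K₁] [IsScalarTower ℝ K₁ K₁]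
  [SMulCommClass ℝ K₁ K₁] [CompositionAlgebra K₁]
variable (K₂ : Type*) [NonAssocRing K₂] [Module ℝ K₂] [IsScalarTower ℝ K₂ K₂]
  [SMulCommClass ℝ K₂ K₂] [CompositionAlgebra K₂]

/-- The linear map identifying `Tri K₁ ∔ Tri K₂ ∔ 3 (K₁ ⊗ K₂)` with `L₃(K₁, K₂)`. -/
def phi : TriModel K₁ K₂ →ₗ[ℝ] Ambient K₁ K₂ :=
  (phiT K₁ K₂).coprod ((phiU K₁ K₂).coprod (∑ i, phiF K₁ K₂ i ∘ₗ LinearMap.proj i))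

variable {K₁ K₂}

theorem phi_apply (u : TriModel K₁ K₂) :
    phi K₁ K₂ u = phiT K₁ K₂ u.1 + (phiU K₁ K₂ u.2.1 + ∑ i, phiF K₁ K₂ i (u.2.2 i)) := by
  simp [phi]

theorem phi_tri (T : Tri K₁) (U : Tri K₂) :
    phi K₁ K₂ (T, U, 0) = phiT K₁ K₂ T + phiU K₁ K₂ U := by
  simp [phi_apply]

theorem phi_F (i : Fin 3) (t : K₁ ⊗[ℝ] K₂) : phi K₁ K₂ (F i t) = phiF K₁ K₂ i t := by
  simp only [phi_apply, F, map_zero, zero_add]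
  rw [Finset.sum_eq_single i]
  · rw [Pi.single_eq_same]
  · intro j _ hj
    rw [Pi.single_eq_of_ne hj, map_zero]
  · simp

theorem tits_phi_tri (S₁ T₁ : Tri K₁) (S₂ T₂ : Tri K₂) :
    tits (phi K₁ K₂ (S₁, S₂, 0)) (phi K₁ K₂ (T₁, T₂, 0)) =
      phi K₁ K₂ (⁅S₁, T₁⁆, ⁅S₂, T₂⁆, 0) := by
  have h : tits (phiU K₁ K₂ S₂) (phiT K₁ K₂ T₁) = 0 := by
    rw [tits_swap, tits_phiT_phiU, neg_zero]
  simp only [phi_tri]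
  rw [← titsHom_apply, map_add, map_add, LinearMap.add_apply, LinearMap.add_apply]
  simp only [titsHom_apply, tits_phiT_phiT, tits_phiU_phiU, tits_phiT_phiU, h]
  abel

theorem tits_phi_tri_F (T : Tri K₁) (U : Tri K₂) (i : Fin 3) (x : K₁) (y : K₂) :
    tits (phi K₁ K₂ (T, U, 0)) (phi K₁ K₂ (F i (x ⊗ₜ y))) =
      phi K₁ K₂ (F i (Tri.comp T i x ⊗ₜ y + x ⊗ₜ Tri.comp U i y)) := by
  rw [phi_tri, phi_F, phi_F, ← titsHom_apply, map_add, LinearMap.add_apply, titsHom_apply,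
    titsHom_apply, tits_phiT_phiF, tits_phiU_phiF, map_add]

theorem tits_phi_F_self (i : Fin 3) (x₁ y₁ : K₁) (x₂ y₂ : K₂) :
    tits (phi K₁ K₂ (F i (x₁ ⊗ₜ x₂))) (phi K₁ K₂ (F i (y₁ ⊗ₜ y₂))) =
      phi K₁ K₂ (form K₂ x₂ y₂ • thetaTxy i x₁ y₁, form K₁ x₁ y₁ • thetaTxy i x₂ y₂, 0) := by
  rw [phi_F, phi_F, phi_tri, tits_phiF_phiF_self]

theorem tits_phi_F_succ (i : Fin 3) (x₁ y₁ : K₁) (x₂ y₂ : K₂) :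
    tits (phi K₁ K₂ (F i (x₁ ⊗ₜ x₂))) (phi K₁ K₂ (F (i + 1) (y₁ ⊗ₜ y₂))) =
      phi K₁ K₂ (F (i + 2) ((conj K₁ y₁ * conj K₁ x₁) ⊗ₜ (conj K₂ y₂ * conj K₂ x₂))) := by
  rw [phi_F, phi_F, phi_F, tits_phiF_phiF_succ]

theorem triModel_induction {p : TriModel K₁ K₂ → Prop} (tri : ∀ T U, p (T, U, 0))
    (hF : ∀ i x y, p (F i (x ⊗ₜ y))) (add : ∀ u v, p u → p v → p (u + v))
    (u : TriModel K₁ K₂) : p u := by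
  have h0 : p 0 := tri 0 0
  have hF' : ∀ i t, p (F i t) := by
    intro i t
    induction t with
    | zero =>
      have : (F i 0 : TriModel K₁ K₂) = 0 := Prod.ext rfl (Prod.ext rfl (Pi.single_zero i))
      rwa [this]
    | tmul x y => exact hF i x y
    | add s t hs ht =>
      have : F i (s + t) = (F i s + F i t : TriModel K₁ K₂) := by
        simp [F, Pi.single_add]
      rw [this]
      exact add _ _ hs ht
  have h : u = (u.1, u.2.1, 0) + (F 0 (u.2.2 0) + (F 1 (u.2.2 1) + F 2 (u.2.2 2))) := by
    refine Prod.ext (by simp [F]) (Prod.ext (by simp [F]) (funext fun i => ?_))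
    fin_cases i <;> simp [F]
  rw [h]
  exact add _ _ (tri _ _) (add _ _ (hF' _ _) (add _ _ (hF' _ _) (hF' _ _)))

variable (K₁ K₂) in
/-- The exchange of the two algebras. -/
def triModelSwap : TriModel K₁ K₂ ≃ₗ[ℝ] TriModel K₂ K₁ where
  toFun u := (u.2.1, u.1, fun i => TensorProduct.comm ℝ K₁ K₂ (u.2.2 i))
  invFun u := (u.2.1, u.1, fun i => TensorProduct.comm ℝ K₂ K₁ (u.2.2 i))
  map_add' u v := by
    refine Prod.ext rfl (Prod.ext rfl (funext fun i => ?_))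
    exact map_add _ _ _
  map_smul' c u := by
    refine Prod.ext rfl (Prod.ext rfl (funext fun i => ?_))
    exact map_smul (TensorProduct.comm ℝ K₁ K₂) c (u.2.2 i)
  left_inv u := by
    refine Prod.ext rfl (Prod.ext rfl (funext fun i => ?_))
    exact (TensorProduct.comm ℝ K₁ K₂).symm_apply_apply _
  right_inv u := by
    refine Prod.ext rfl (Prod.ext rfl (funext fun i => ?_))
    exact (TensorProduct.comm ℝ K₂ K₁).symm_apply_apply _

theorem triModelSwap_tri (T : Tri K₁) (U : Tri K₂) :
    triModelSwap K₁ K₂ (T, U, 0) = (U, T, 0) := by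
  refine Prod.ext rfl (Prod.ext rfl (funext fun i => ?_))
  exact map_zero _

theorem triModelSwap_F (i : Fin 3) (t : K₁ ⊗[ℝ] K₂) :
    triModelSwap K₁ K₂ (F i t) = F i (TensorProduct.comm ℝ K₁ K₂ t) := by
  refine Prod.ext rfl (Prod.ext rfl (funext fun j => ?_))
  exact Pi.apply_single (fun _ => TensorProduct.comm ℝ K₁ K₂) (fun _ => map_zero _) i t j

/-- The image of `phi` is closed under the bracket, which is symmetric in the two algebras. -/
theorem exists_tits_phi (u v : TriModel K₁ K₂) : ∃ w : TriModel K₁ K₂,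
    tits (phi K₁ K₂ u) (phi K₁ K₂ v) = phi K₁ K₂ w ∧
      tits (phi K₂ K₁ (triModelSwap K₁ K₂ u)) (phi K₂ K₁ (triModelSwap K₁ K₂ v)) =
        phi K₂ K₁ (triModelSwap K₁ K₂ w) := by
  have symm : ∀ u v : TriModel K₁ K₂, (∃ w : TriModel K₁ K₂,
      tits (phi K₁ K₂ u) (phi K₁ K₂ v) = phi K₁ K₂ w ∧
      tits (phi K₂ K₁ (triModelSwap K₁ K₂ u)) (phi K₂ K₁ (triModelSwap K₁ K₂ v)) =
        phi K₂ K₁ (triModelSwap K₁ K₂ w)) → ∃ w : TriModel K₁ K₂,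
      tits (phi K₁ K₂ v) (phi K₁ K₂ u) = phi K₁ K₂ w ∧
      tits (phi K₂ K₁ (triModelSwap K₁ K₂ v)) (phi K₂ K₁ (triModelSwap K₁ K₂ u)) =
        phi K₂ K₁ (triModelSwap K₁ K₂ w) := by
    rintro u v ⟨w, h1, h2⟩
    exact ⟨-w, by rw [tits_swap, h1, map_neg], by rw [tits_swap, h2, map_neg, map_neg]⟩
  have mixed : ∀ (T : Tri K₁) (U : Tri K₂) (i : Fin 3) (x : K₁) (y : K₂),
      ∃ w : TriModel K₁ K₂,
      tits (phi K₁ K₂ (T, U, 0)) (phi K₁ K₂ (F i (x ⊗ₜ y))) = phi K₁ K₂ w ∧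
      tits (phi K₂ K₁ (triModelSwap K₁ K₂ (T, U, 0)))
        (phi K₂ K₁ (triModelSwap K₁ K₂ (F i (x ⊗ₜ y)))) = phi K₂ K₁ (triModelSwap K₁ K₂ w) := by
    intro T U i x y
    refine ⟨_, tits_phi_tri_F T U i x y, ?_⟩
    rw [triModelSwap_tri, triModelSwap_F, triModelSwap_F, map_add, TensorProduct.comm_tmul,
      TensorProduct.comm_tmul, TensorProduct.comm_tmul, tits_phi_tri_F, add_comm]
  have succ : ∀ (i : Fin 3) (x₁ y₁ : K₁) (x₂ y₂ : K₂), ∃ w : TriModel K₁ K₂,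
      tits (phi K₁ K₂ (F i (x₁ ⊗ₜ x₂))) (phi K₁ K₂ (F (i + 1) (y₁ ⊗ₜ y₂))) = phi K₁ K₂ w ∧
      tits (phi K₂ K₁ (triModelSwap K₁ K₂ (F i (x₁ ⊗ₜ x₂))))
        (phi K₂ K₁ (triModelSwap K₁ K₂ (F (i + 1) (y₁ ⊗ₜ y₂)))) =
          phi K₂ K₁ (triModelSwap K₁ K₂ w) := by
    intro i x₁ y₁ x₂ y₂
    refine ⟨_, tits_phi_F_succ i x₁ y₁ x₂ y₂, ?_⟩
    rw [triModelSwap_F, triModelSwap_F, triModelSwap_F, TensorProduct.comm_tmul,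
      TensorProduct.comm_tmul, TensorProduct.comm_tmul, tits_phi_F_succ]
  induction u using triModel_induction with
  | tri S₁ S₂ =>
    induction v using triModel_induction with
    | tri T₁ T₂ =>
      refine ⟨_, tits_phi_tri S₁ T₁ S₂ T₂, ?_⟩
      rw [triModelSwap_tri, triModelSwap_tri, triModelSwap_tri, tits_phi_tri]
    | hF i x y => exact mixed S₁ S₂ i x y
    | add v v' hv hv' =>
      obtain ⟨w, h1, h2⟩ := hv
      obtain ⟨w', h1', h2'⟩ := hv'
      simp only [← titsHom_apply] at *
      exact ⟨w + w', by simp only [map_add, h1, h1'], by simp only [map_add, h2, h2']⟩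
  | hF i x₁ x₂ =>
    induction v using triModel_induction with
    | tri T₁ T₂ => exact symm _ _ (mixed T₁ T₂ i x₁ x₂)
    | hF j y₁ y₂ =>
      rcases fin3_cases i j with rfl | rfl | rfl
      · refine ⟨_, tits_phi_F_self j x₁ y₁ x₂ y₂, ?_⟩
        rw [triModelSwap_tri, triModelSwap_F, triModelSwap_F, TensorProduct.comm_tmul,
          TensorProduct.comm_tmul, tits_phi_F_self]
      · exact succ i x₁ y₁ x₂ y₂
      · have := succ (i + 2) y₁ x₁ y₂ x₂
        rw [fin3_add_two_add_one] at this
        exact symm _ _ this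
    | add v v' hv hv' =>
      obtain ⟨w, h1, h2⟩ := hv
      obtain ⟨w', h1', h2'⟩ := hv'
      simp only [← titsHom_apply] at *
      exact ⟨w + w', by simp only [map_add, h1, h1'], by simp only [map_add, h2, h2']⟩
  | add u u' hu hu' =>
    obtain ⟨w, h1, h2⟩ := hu
    obtain ⟨w', h1', h2'⟩ := hu'
    simp only [← titsHom_apply] at *
    exact ⟨w + w', by simp only [map_add, LinearMap.add_apply, h1, h1'],
      by simp only [map_add, LinearMap.add_apply, h2, h2']⟩

/-! ### Injectivity and image of the identification -/

variable (K₁ K₂) in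
/-- The map `x ⊗ y ↦ ⟨y, 1⟩ x`. -/
def reTensor : K₁ ⊗[ℝ] K₂ →ₗ[ℝ] K₁ :=
  (TensorProduct.rid ℝ K₁).toLinearMap ∘ₗ LinearMap.lTensor K₁ ((form K₂).flip 1)

variable (K₁ K₂) in
/-- The map `x ⊗ y ↦ x ⊗ (y - ⟨y, 1⟩ 1)`. -/
def imTensor : K₁ ⊗[ℝ] K₂ →ₗ[ℝ] K₁ ⊗[ℝ] K₂ :=
  LinearMap.lTensor K₁ (LinearMap.id - ((form K₂).flip 1).smulRight (1 : K₂))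

theorem phiF_apply (i : Fin 3) (t : K₁ ⊗[ℝ] K₂) : phiF K₁ K₂ i t =
    (-dOff i (reTensor K₁ K₂ t), -LinearMap.rTensor K₂ (off i) (imTensor K₁ K₂ t), 0) := by
  have h : LinearMap.rTensor K₂ (off i) ∘ₗ imTensor K₁ K₂ = TensorProduct.map (off i)
      (LinearMap.id - ((form K₂).flip 1).smulRight (1 : K₂)) := by
    rw [imTensor, LinearMap.rTensor_comp_lTensor]
  exact Prod.ext rfl (Prod.ext (congrArg Neg.neg (LinearMap.congr_fun h t).symm) neg_zero)

theorem tensor_decomp (t : K₁ ⊗[ℝ] K₂) :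
    t = imTensor K₁ K₂ t + reTensor K₁ K₂ t ⊗ₜ 1 := by
  induction t with
  | zero => simp
  | tmul x y => simp [imTensor, reTensor, TensorProduct.smul_tmul]
  | add s t hs ht =>
    rw [map_add, map_add, TensorProduct.add_tmul]
    nth_rewrite 1 [hs, ht]
    abel

/-- Coordinates recover every summand: the value of the derivation part on `e_{i+1}` gives the real
part of the `i`-th tensor, the off-diagonal entries of the middle part give its imaginary part, and
then `T`, the `a_i` and `D` can be read off. -/
theorem phi_injective : Function.Injective (phi K₁ K₂) := by
  rw [← LinearMap.ker_eq_bot, LinearMap.ker_eq_bot']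
  rintro ⟨T, U, f⟩ h
  simp only [phi_apply, phiT_apply, phiU_apply, phiF_apply] at h
  have h1 := congrArg Prod.fst h
  have h2 := congrArg (fun u => u.2.1) h
  have h3 := congrArg (fun u => u.2.2) h
  simp only [Prod.fst_add, Prod.snd_add, Prod.fst_sum, Prod.snd_sum, Prod.fst_zero,
    Prod.snd_zero, Finset.sum_const_zero, zero_add, add_zero] at h1 h2 h3
  have hre : ∀ i, reTensor K₁ K₂ (f i) = 0 := by
    intro i
    obtain ⟨-, -, -, e4, e5, e6⟩ := fin3_single i 1
    have := congrArg (fun D : Module.End ℝ (H3 K₁) =>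
      offCoord i (D (diag K₁ (Pi.single (i + 1) 1)))) h1
    simp only [fin3_sum i, LinearMap.add_apply, LinearMap.neg_apply, derT_diag, dOff_diag, map_add,
      map_neg, map_smul, map_zero, offCoord_off_self, LinearMap.zero_apply, Pi.single_eq_same, e4,
      offCoord_off_of_ne (show i ≠ i + 1 by omega),
      offCoord_off_of_ne (show i ≠ i + 2 by omega)] at this
    simpa using this
  have him : ∀ i, imTensor K₁ K₂ (f i) = 0 := by
    intro i
    have hij : ∀ j, j ≠ i → (offCoord i ∘ₗ off j : K₁ →ₗ[ℝ] K₁) = 0 := fun j hj =>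
      LinearMap.ext fun x => offCoord_off_of_ne hj.symm x
    have hii : (offCoord i ∘ₗ off i : K₁ →ₗ[ℝ] K₁) = LinearMap.id :=
      LinearMap.ext fun x => offCoord_off_self i x
    have := congrArg (LinearMap.rTensor K₂ (offCoord i)) h2
    simp only [map_add, map_sum, map_neg, LinearMap.rTensor_tmul, offCoord_diag,
      TensorProduct.zero_tmul, Finset.sum_const_zero, zero_add, map_zero,
      ← LinearMap.rTensor_comp_apply] at this
    rw [Finset.sum_eq_single i (fun j _ hj => by
      rw [hij j hj, LinearMap.rTensor_zero, LinearMap.zero_apply, neg_zero]) (by simp), hii,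
      LinearMap.rTensor_id, LinearMap.id_apply, neg_eq_zero] at this
    exact this
  have hf : f = 0 := by
    funext i
    rw [tensor_decomp (f i), hre, him, TensorProduct.zero_tmul, add_zero]
    rfl
  have hT : T = 0 := by
    apply Tri.ext_comp
    intro i
    ext x
    simp only [hre, map_zero, neg_zero, Finset.sum_const_zero, add_zero] at h1
    have := congrArg (fun D : Module.End ℝ (H3 K₁) => offCoord i (D (off i x))) h1
    simp only [derT_off, offCoord_off_self, LinearMap.zero_apply, map_zero] at this
    rw [this, ← zero_smul ℝ (0 : Tri K₁), Tri.comp_smul, zero_smul, LinearMap.zero_apply]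
  have hU : U = 0 := by
    have hv : ∀ i, triVec i U = 0 := by
      intro i
      simp only [him, map_zero, neg_zero, Finset.sum_const_zero, add_zero] at h2
      have := congrArg (fun t => TensorProduct.lid ℝ K₂ (LinearMap.rTensor K₂ (diagCoord i) t)) h2
      simp only [map_sum, LinearMap.rTensor_tmul, diagCoord_diag, TensorProduct.lid_tmul,
        map_zero, Pi.single_apply] at this
      simpa using this
    apply Tri.ext_comp
    intro i
    rw [comp_eq U, hv, hv, h3, ← zero_smul ℝ (0 : Tri K₂), Tri.comp_smul, zero_smul]
    ext z
    simp
  rw [hT, hU, hf]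
  rfl

theorem tr_eq_zero_iff {A : H3 K₁} : A ∈ H3' K₁ ↔ ∑ i, diagCoord i A = 0 := by
  change tr K₁ A = 0 ↔ _
  rw [A.decomp, map_add, map_sum, tr_diag]
  simp only [tr_off, Finset.sum_const_zero, add_zero, smul_eq_zero, one_ne_zero, or_false, map_add,
    map_sum, diagCoord_diag, diagCoord_off]

theorem phiT_mem (T : Tri K₁) : phiT K₁ K₂ T ∈ L3 K₁ K₂ :=
  ⟨derT_mem T, Submodule.zero_mem _, Submodule.zero_mem _⟩

theorem phiU_mem (U : Tri K₂) : phiU K₁ K₂ U ∈ L3 K₁ K₂ := by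
  rw [phiU_apply]
  refine ⟨Submodule.zero_mem _, ?_, triDer_mul U⟩
  have e : triVec 2 U = -triVec 0 U - triVec 1 U := by
    have := triVec_add U 0
    change triVec 0 U + triVec 1 U + triVec 2 U = 0 at this
    linear_combination (norm := module) this
  -- The individual `e_i` are not traceless. Eliminating `a₂` by the sum-zero relation leaves only
  -- `e₀ - e₂` and `e₁ - e₂`, which are.
  have h : (∑ i, diag K₁ (Pi.single i 1) ⊗ₜ triVec i U : H3 K₁ ⊗[ℝ] K₂) =
      (diag K₁ (Pi.single 0 1 - Pi.single 2 1)) ⊗ₜ triVec 0 U +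
        (diag K₁ (Pi.single 1 1 - Pi.single 2 1)) ⊗ₜ triVec 1 U := by
    rw [Fin.sum_univ_three, e]
    simp only [map_sub, TensorProduct.sub_tmul, TensorProduct.tmul_sub, TensorProduct.tmul_neg]
    abel
  have hm : ∀ i, diag K₁ (Pi.single i 1 - Pi.single 2 1) ∈ H3' K₁ := by
    intro i
    rw [tr_eq_zero_iff]
    simp
  change (∑ i, diag K₁ (Pi.single i 1) ⊗ₜ triVec i U : H3 K₁ ⊗[ℝ] K₂) ∈ _
  rw [h]
  exact Submodule.add_mem _ (Submodule.apply_mem_map₂ _ (hm 0) (form_triVec_one U 0))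
    (Submodule.apply_mem_map₂ _ (hm 1) (form_triVec_one U 1))

theorem phiF_mem (i : Fin 3) (t : K₁ ⊗[ℝ] K₂) : phiF K₁ K₂ i t ∈ L3 K₁ K₂ := by
  induction t with
  | zero =>
    rw [map_zero]
    exact Submodule.zero_mem _
  | tmul x y =>
    induction y using im_induction with
    | one =>
      rw [phiF_one, ← map_neg]
      exact ⟨dOff_mem i (-x), Submodule.zero_mem _, Submodule.zero_mem _⟩
    | im a ha =>
      rw [phiF_im _ _ ha]
      refine ⟨Submodule.zero_mem _, Submodule.neg_mem _ (Submodule.apply_mem_map₂ _ ?_ ha),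
        Submodule.zero_mem _⟩
      rw [tr_eq_zero_iff]
      simp
    | add y y' hy hy' =>
      rw [TensorProduct.tmul_add, map_add]
      exact Submodule.add_mem _ hy hy'
    | smul r y hy =>
      rw [TensorProduct.tmul_smul, map_smul]
      exact Submodule.smul_mem _ r hy
  | add s t hs ht =>
    rw [map_add]
    exact Submodule.add_mem _ hs ht

theorem phiT_mem_range (T : Tri K₁) : phiT K₁ K₂ T ∈ LinearMap.range (phi K₁ K₂) :=
  ⟨(T, 0, 0), by rw [phi_tri, map_zero, add_zero]⟩

theorem phiU_mem_range (U : Tri K₂) : phiU K₁ K₂ U ∈ LinearMap.range (phi K₁ K₂) :=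
  ⟨(0, U, 0), by rw [phi_tri, map_zero, zero_add]⟩

theorem phiF_mem_range (i : Fin 3) (t : K₁ ⊗[ℝ] K₂) :
    phiF K₁ K₂ i t ∈ LinearMap.range (phi K₁ K₂) :=
  ⟨F i t, phi_F i t⟩

theorem der_mem_range_phi {D : Module.End ℝ (H3 K₁)} (hD : D ∈ Der (jordan K₁)) :
    ((D, 0, 0) : Ambient K₁ K₂) ∈ LinearMap.range (phi K₁ K₂) := by
  obtain ⟨T, x, rfl⟩ := exists_derT_add_dOff hD
  have h : ((derT K₁ T + ∑ i, dOff i (x i), 0, 0) : Ambient K₁ K₂) =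
      phiT K₁ K₂ T + ∑ i, phiF K₁ K₂ i ((-x i) ⊗ₜ 1) := by
    rw [phiT_apply, Fin.sum_univ_three, Fin.sum_univ_three]
    simp [phiF_one]
  rw [h]
  exact Submodule.add_mem _ (phiT_mem_range T) (Submodule.sum_mem _ fun i _ => phiF_mem_range i _)

theorem derivation_mem_range_phi {E : Module.End ℝ K₂}
    (hE : ∀ x y, E (x * y) = E x * y + x * E y) :
    ((0, 0, E) : Ambient K₁ K₂) ∈ LinearMap.range (phi K₁ K₂) := by
  obtain ⟨U, hU⟩ := exists_tri_of_derivation hE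
  obtain ⟨h1, h2⟩ := triVec_triDer_unique (T := U) (D := E) (a := fun _ => 0)
    (fun i => by rw [hU]; ext; simp) (derivation_one hE) (by simp)
  have := phiU_mem_range (K₁ := K₁) U
  rw [phiU_apply, h2] at this
  simpa [h1] using this

theorem tmul_mem_range_phi {A : H3 K₁} (hA : A ∈ H3' K₁) {a : K₂} (ha : a ∈ imK K₂) :
    ((0, A ⊗ₜ a, 0) : Ambient K₁ K₂) ∈ LinearMap.range (phi K₁ K₂) := by
  rw [tr_eq_zero_iff] at hA
  have ha' : form K₂ a 1 = 0 := ha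
  have hs : ∀ i, diagCoord i A • a + diagCoord (i + 1) A • a + diagCoord (i + 2) A • a = 0 := by
    intro i
    rw [fin3_sum i] at hA
    rw [← add_smul, ← add_smul, hA, zero_smul]
  -- The diagonal of `A` times `a` is a sum-zero family exactly because `A` is traceless, so the
  -- diagonal part of `A ⊗ a` comes from a triality with `D = 0`.
  obtain ⟨U, hU⟩ := exists_tri_mul (a := fun i => diagCoord i A • a)
    (fun i => by simp [ha']) (hs 0)
  obtain ⟨h1, h2⟩ := triVec_triDer_unique (T := U) (D := 0) (a := fun i => diagCoord i A • a)
    (fun i => by rw [hU, zero_add]) rfl hs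
  have hd : diag K₁ (fun i => diagCoord i A) = ∑ i, diagCoord i A • diag K₁ (Pi.single i 1) := by
    simp only [← map_smul, ← map_sum]
    congr 1
    ext i
    simp [Pi.single_apply]
  have h : ((0, A ⊗ₜ a, 0) : Ambient K₁ K₂) =
      phiU K₁ K₂ U + ∑ i, phiF K₁ K₂ i ((-offCoord i A) ⊗ₜ a) := by
    rw [phiU_apply, h2]
    simp only [h1, phiF_im _ _ ha', Fin.sum_univ_three, map_neg, TensorProduct.neg_tmul]
    refine Prod.ext (by simp) (Prod.ext ?_ (by simp))
    simp only [Prod.snd_add, Prod.fst_add, Prod.snd_neg, Prod.fst_neg, neg_neg]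
    nth_rewrite 1 [A.decomp]
    rw [hd, Fin.sum_univ_three, Fin.sum_univ_three]
    simp only [TensorProduct.add_tmul, TensorProduct.smul_tmul]
  rw [h]
  exact Submodule.add_mem _ (phiU_mem_range U) (Submodule.sum_mem _ fun i _ => phiF_mem_range i _)

theorem range_phi : LinearMap.range (phi K₁ K₂) = L3 K₁ K₂ := by
  apply le_antisymm
  · rintro _ ⟨u, rfl⟩
    rw [phi_apply]
    exact Submodule.add_mem _ (phiT_mem _) (Submodule.add_mem _ (phiU_mem _)
      (Submodule.sum_mem _ fun i _ => phiF_mem _ _))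
  · rintro ⟨D, t, E⟩ ⟨hD, ht, hE⟩
    have hmid : ((0, t, 0) : Ambient K₁ K₂) ∈ LinearMap.range (phi K₁ K₂) := by
      have hle : Submodule.map₂ (TensorProduct.mk ℝ (H3 K₁) K₂) (H3' K₁) (imK K₂) ≤
          (LinearMap.range (phi K₁ K₂)).comap
            (LinearMap.inr ℝ (Module.End ℝ (H3 K₁)) _ ∘ₗ
              LinearMap.inl ℝ (H3 K₁ ⊗[ℝ] K₂) (Module.End ℝ K₂)) :=
        Submodule.map₂_le.2 fun A hA a ha => tmul_mem_range_phi hA ha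
      exact hle ht
    have h : ((D, t, E) : Ambient K₁ K₂) = (D, 0, 0) + ((0, t, 0) + (0, 0, E)) := by simp
    rw [h]
    exact Submodule.add_mem _ (der_mem_range_phi hD)
      (Submodule.add_mem _ hmid (derivation_mem_range_phi hE))

variable (K₁ K₂) in
/-- The identification of `Tri K₁ ∔ Tri K₂ ∔ 3 (K₁ ⊗ K₂)` with `L₃(K₁, K₂)`. -/
def phiEquiv : TriModel K₁ K₂ ≃ₗ[ℝ] L3 K₁ K₂ :=
  (LinearEquiv.ofInjective (phi K₁ K₂) phi_injective).trans (LinearEquiv.ofEq _ _ range_phi)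

theorem coe_phiEquiv (u : TriModel K₁ K₂) : (phiEquiv K₁ K₂ u : Ambient K₁ K₂) = phi K₁ K₂ u := rfl

end Iso

end MagicSquare

end

theorem theorem3
    {K₁ : Type*} [NonAssocRing K₁] [Module ℝ K₁] [IsScalarTower ℝ K₁ K₁] [SMulCommClass ℝ K₁ K₁]
    [CompositionAlgebra K₁]
    {K₂ : Type*} [NonAssocRing K₂] [Module ℝ K₂] [IsScalarTower ℝ K₂ K₂] [SMulCommClass ℝ K₂ K₂]
    [CompositionAlgebra K₂] :
    -- the bracket of `L₃(K₁, K₂)` is a skew-symmetric operation on `L₃(K₁, K₂)`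
    (∀ u ∈ L3 K₁ K₂, ∀ v ∈ L3 K₁ K₂, tits u v ∈ L3 K₁ K₂ ∧ tits v u = -tits u v) ∧
    -- `L₃(K₁, K₂) = Tri K₁ ⊕ Tri K₂ ∔ 3 (K₁ ⊗ K₂)`
    (∃ Φ : TriModel K₁ K₂ ≃ₗ[ℝ] L3 K₁ K₂,
      -- `Tri K₁ ⊕ Tri K₂` is a Lie subalgebra
      (∀ (S₁ T₁ : Tri K₁) (S₂ T₂ : Tri K₂),
        tits (Φ (S₁, S₂, 0) : Ambient K₁ K₂) (Φ (T₁, T₂, 0)) = Φ (⁅S₁, T₁⁆, ⁅S₂, T₂⁆, 0)) ∧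
      (∀ (T₁ : Tri K₁) (i : Fin 3) (x₁ : K₁) (x₂ : K₂),
        tits (Φ (T₁, 0, 0) : Ambient K₁ K₂) (Φ (F i (x₁ ⊗ₜ x₂))) =
          Φ (F i (Tri.comp T₁ i x₁ ⊗ₜ x₂))) ∧
      (∀ (T₂ : Tri K₂) (i : Fin 3) (x₁ : K₁) (x₂ : K₂),
        tits (Φ (0, T₂, 0) : Ambient K₁ K₂) (Φ (F i (x₁ ⊗ₜ x₂))) =
          Φ (F i (x₁ ⊗ₜ Tri.comp T₂ i x₂))) ∧
      -- `(i, i + 1, i + 2)` runs through the cyclic permutations of the three indices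
      (∀ (i : Fin 3) (x₁ y₁ : K₁) (x₂ y₂ : K₂),
        tits (Φ (F i (x₁ ⊗ₜ x₂)) : Ambient K₁ K₂) (Φ (F (i + 1) (y₁ ⊗ₜ y₂))) =
          Φ (F (i + 2) ((conj K₁ y₁ * conj K₁ x₁) ⊗ₜ (conj K₂ y₂ * conj K₂ x₂)))) ∧
      -- the power `θ ^ (-i)` for `i : Fin 3` is `θ ^ (1 - i)` for indices `1, 2, 3`
      (∀ (i : Fin 3) (x₁ y₁ : K₁) (x₂ y₂ : K₂),
        tits (Φ (F i (x₁ ⊗ₜ x₂)) : Ambient K₁ K₂) (Φ (F i (y₁ ⊗ₜ y₂))) =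
          Φ (form K₂ x₂ y₂ • (⇑(theta K₁).symm)^[(i : ℕ)] (Txy x₁ y₁),
            form K₁ x₁ y₁ • (⇑(theta K₂).symm)^[(i : ℕ)] (Txy x₂ y₂), 0))) ∧
    -- the symmetry of the magic square
    (∃ Ψ : L3 K₁ K₂ ≃ₗ[ℝ] L3 K₂ K₁, ∀ u v w : L3 K₁ K₂,
      tits (u : Ambient K₁ K₂) v = w → tits (Ψ u : Ambient K₂ K₁) (Ψ v) = Ψ w) := by
  refine ⟨fun u hu v hv => ⟨?_, tits_swap u v⟩, ⟨phiEquiv K₁ K₂, tits_phi_tri, ?_, ?_,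
    tits_phi_F_succ, tits_phi_F_self⟩, ?_⟩
  · rw [← range_phi] at hu hv ⊢
    obtain ⟨u, rfl⟩ := hu
    obtain ⟨v, rfl⟩ := hv
    obtain ⟨w, hw, -⟩ := exists_tits_phi u v
    exact ⟨w, hw.symm⟩
  · intro T i x₁ x₂
    simp only [coe_phiEquiv, phi_tri, phi_F, map_zero, add_zero]
    exact tits_phiT_phiF T i x₁ x₂
  · intro U i x₁ x₂
    simp only [coe_phiEquiv, phi_tri, phi_F, map_zero, zero_add]
    exact tits_phiU_phiF U i x₁ x₂
  · refine ⟨(phiEquiv K₁ K₂).symm.trans ((triModelSwap K₁ K₂).trans (phiEquiv K₂ K₁)), ?_⟩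
    intro u v w h
    obtain ⟨u, rfl⟩ := (phiEquiv K₁ K₂).surjective u
    obtain ⟨v, rfl⟩ := (phiEquiv K₁ K₂).surjective v
    obtain ⟨w, rfl⟩ := (phiEquiv K₁ K₂).surjective w
    obtain ⟨w', h1, h2⟩ := exists_tits_phi u v
    -- `exists_tits_phi` provides one preimage that computes the bracket on both sides; injectivity
    -- identifies it with the given `w`.
    have e : w = w' := phi_injective (h.symm.trans h1)
    simp only [LinearEquiv.trans_apply, LinearEquiv.symm_apply_apply, coe_phiEquiv]
    rw [e]
    exact h2
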